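/- Let $\mathcal X,\mathcal Y$ be finite sets, $\star\in\mathcal X$, let $Q(y|x)$ be a memoryless channel from $\mathcal X$ to $\mathcal Y$, and put $Q_\star=Q(\cdot|\star)$. Logarithms are natural, $D(p\|q)=\sum_y p(y)\ln\frac{p(y)}{q(y)}\in[0,\infty]$, and $D(W\|V|P)=\sum_x P(x)D(W(\cdot|x)\|V(\cdot|x))$ with $0\cdot\infty=0$. Let $C$ be the (block-coding) capacity, in nats per channel use, of the ordinary synchronous channel $Q$. An asynchronous code of length $n$ at asynchronism level $A\in\{1,2,\dots\}$ consists of $M\ge 2$ codewords $c(1),\dots,c(M)\in\mathcal X^n$, a (possibly randomized) stopping time $\tau\in\{1,\dots,A+n-1\}$ with respect to the outputs $Y_1,\dots,Y_{A+n-1}$, and a decision $\phi(Y_1,\dots,Y_\tau)\in\{1,\dots,M\}$. Under $\mathbb P_{m,t}$ ($1\le m\le M$, $1\le t\le A$) the outputs are independent, $Y_i\sim Q(\cdot|c_{i-t+1}(m))$ for $t\le i\le t+n-1$, and $Y_i\sim Q_\star$ for every other $i$. The error probability of the code is $\max_m\frac1A\sum_{t=1}^A\mathbb P_{m,t}(\phi\ne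 m)$, its delay is $\Delta=\max_m\frac1A\sum_{t=1}^A\mathbb E_{m,t}[(\tau-t)^+]$, and its rate is $\ln M/\Delta$ ($=\infty$ if $\Delta=0$). A pair $(R,\alpha)$ with $R,\alpha\ge0$ is achievable if there is a sequence of codes, the $n$-th of length $n$ and level $A_n$, such that for every $\epsilon>0$ and all large enough $n$: $e^{(\alpha-\epsilon)n}\le A_n\le e^{\alpha n}$, the rate is at least $R-\epsilon$, and the error probability is at most $\epsilon$. Let $\alpha(R)\in[0,\infty]$ be the supremum of the $\alpha$ such that $(R,\alpha)$ is achievable. Theorem. If $\alpha_\circ:=\max_{x}D(Q(\cdot|x)\|Q_\star)=\infty$ (that is, some output that $Q$ can produce cannot be produced by the noise distribution $Q_\star$), then for all $R\in(0,C]$ $$\alpha(R)=\max_{P}\min_{W}\max\{D(W\|Q|P),\,D(W\|Q_\star|P)\},$$ where $P$ ranges over the distributions on $\mathcal X$ and $W$ over the conditional distributions from $\mathcal X$ to $\mathcal Y$; the maximum and the minima are attained, and the common value may be $\infty$. In particular $\alpha(R)$ does not depend on $R\in(0,C]$. -/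

import Mathlib

open scoped NNReal ENNReal BigOperators

noncomputable section

namespace AsyncComm

/-- Probability distributions on a finite alphabet. -/
abbrev ProbDist (S : Type*) [Fintype S] : Type _ := stdSimplex ℝ S

/-- Transition matrices (conditional distributions) from `X` to `Y`; `(Q x).1 y` is `Q(y|x)`. -/
abbrev Channel (X Y : Type*) [Fintype Y] : Type _ := X → ProbDist Y

section Information

variable {X Y : Type*} [Fintype X] [Fintype Y]

open Classical in
/-- The information divergence `D(p‖q)`, in nats, with value `∞` unless `p ≪ q`. -/
def kl (p q : ProbDist Y) : ℝ≥0∞ :=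
  if ∀ y, q.1 y = 0 → p.1 y = 0 then
    ENNReal.ofReal (∑ y, p.1 y * Real.log (p.1 y / q.1 y))
  else ⊤

/-- The conditional divergence `D(W‖V|P) = ∑ₓ P(x) D(W(·|x)‖V(·|x))`, with `0 · ∞ = 0`. -/
def condKL (W V : Channel X Y) (P : ProbDist X) : ℝ≥0∞ :=
  ∑ x, ENNReal.ofReal (P.1 x) * kl (W x) (V x)

/-- The synchronization threshold `max_x D(Q(·|x)‖Q_⋆)`, where `Q_⋆ = Q(·|⋆)`. -/
def syncThreshold (Q : Channel X Y) (star : X) : ℝ≥0∞ :=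
  ⨆ x, kl (Q x) (Q star)

/-- `max {D(W‖Q|P), D(W‖Q_⋆|P)}`. -/
def maxDiv (Q : Channel X Y) (star : X) (P : ProbDist X) (W : Channel X Y) : ℝ≥0∞ :=
  max (condKL W Q P) (condKL W (fun _ => Q star) P)

/-- The value of `max_P min_W max {D(W‖Q|P), D(W‖Q_⋆|P)}` (possibly `∞`). -/
def alphaBar (Q : Channel X Y) (star : X) : ℝ≥0∞ :=
  ⨆ P : ProbDist X, ⨅ W : Channel X Y, maxDiv Q star P W

end Information

section Synchronous

variable {X Y : Type*} [Fintype Y]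

/-- The memoryless law `Q(yⁿ|xⁿ) = ∏ᵢ Q(yᵢ|xᵢ)`. -/
def memoryless (Q : Channel X Y) {N : ℕ} (x : Fin N → X) (y : Fin N → Y) : ℝ :=
  ∏ i, (Q (x i)).1 (y i)

/-- An ordinary (synchronous) block code of length `n`. -/
structure BlockCode (X Y : Type*) (n : ℕ) where
  /-- number of messages -/
  M : ℕ
  one_le_M : 1 ≤ M
  /-- the codewords -/
  codeword : Fin M → Fin n → X
  /-- the decoder -/
  decode : (Fin n → Y) → Fin M

/-- Maximum (over messages) error probability of a block code. -/
def BlockCode.maxError {n : ℕ} (c : BlockCode X Y n) (Q : Channel X Y) : ℝ :=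
  ⨆ m : Fin c.M, ∑ y : Fin n → Y,
    if c.decode y ≠ m then memoryless Q (c.codeword m) y else 0

/-- `R` is an achievable rate, in nats per channel use, on the synchronous channel. -/
def SyncAchievable (Q : Channel X Y) (R : ℝ≥0) : Prop :=
  ∃ c : ∀ n : ℕ, BlockCode X Y n, ∀ ε : ℝ, 0 < ε → ∀ᶠ n in Filter.atTop,
    ((R : ℝ) - ε) * n ≤ Real.log (c n).M ∧ (c n).maxError Q ≤ ε

/-- The capacity `C` of the synchronous channel. -/
def syncCapacity (Q : Channel X Y) : ℝ≥0∞ :=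
  sSup ((fun R : ℝ≥0 => (R : ℝ≥0∞)) '' {R | SyncAchievable Q R})

end Synchronous

section Asynchronous

variable {X Y : Type*} [Fintype Y]

/-- A code with codewords of length `n` for the asynchronous channel, operating at asynchronism
level `A`.  Instants `1, …, A + n - 1` are indexed by `Fin (A + n - 1)`, so the index `k` stands for
the instant `k + 1`.  The (possibly randomized) stopping time `τ` is given by its conditional law
given the outputs: the probability that `τ` is the instant of index `k` is a function of the outputs
up to that instant. The decision is likewise a function of the outputs observed until stopping. -/
structure AsyncCode (X Y : Type*) (n : ℕ) where
  /-- number of messages -/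
  M : ℕ
  two_le_M : 2 ≤ M
  /-- asynchronism level -/
  A : ℕ
  one_le_A : 1 ≤ A
  /-- the codewords -/
  codeword : Fin M → Fin n → X
  /-- `stopProb k y` is the probability that `τ` is the instant of index `k`, given the outputs `y` -/
  stopProb : Fin (A + n - 1) → (Fin (A + n - 1) → Y) → ℝ
  stopProb_nonneg : ∀ k y, 0 ≤ stopProb k y
  stopProb_sum : ∀ y, ∑ k, stopProb k y = 1
  stopProb_adapted : ∀ k y y', (∀ j, j ≤ k → y j = y' j) → stopProb k y = stopProb k y'
  /-- the message declared when stopping at the instant of index `k` -/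
  decision : Fin (A + n - 1) → (Fin (A + n - 1) → Y) → Fin M
  decision_adapted : ∀ k y y', (∀ j, j ≤ k → y j = y' j) → decision k y = decision k y'

namespace AsyncCode

variable {n : ℕ} (c : AsyncCode X Y n)

/-- The channel inputs when message `m` starts being sent at the instant of index `t`: the codeword
occupies `n` consecutive instants from there on, and the input is `⋆` at all other instants. -/
def input (star : X) (m : Fin c.M) (t : Fin c.A) (i : Fin (c.A + n - 1)) : X :=
  if h : t.1 ≤ i.1 ∧ i.1 < t.1 + n then c.codeword m ⟨i.1 - t.1, by omega⟩ else star

/-- The law `P_{m,t}` of the outputs, given the message `m` and the starting time `t`. -/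
def outputProb (Q : Channel X Y) (star : X) (m : Fin c.M) (t : Fin c.A)
    (y : Fin (c.A + n - 1) → Y) : ℝ :=
  memoryless Q (c.input star m t) y

/-- `P_{m,t}(φ(Y^τ) ≠ m)`. -/
def errorProb (Q : Channel X Y) (star : X) (m : Fin c.M) (t : Fin c.A) : ℝ :=
  ∑ y, c.outputProb Q star m t y * ∑ k, if c.decision k y ≠ m then c.stopProb k y else 0

/-- `E_{m,t}[(τ - t)⁺]`. -/
def expectedDelay (Q : Channel X Y) (star : X) (m : Fin c.M) (t : Fin c.A) : ℝ :=
  ∑ y, c.outputProb Q star m t y * ∑ k, c.stopProb k y * max 0 ((k.1 : ℝ) - (t.1 : ℝ))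

/-- The maximum over messages of the error probability averaged over the starting time. -/
def maxError (Q : Channel X Y) (star : X) : ℝ :=
  ⨆ m : Fin c.M, (1 / (c.A : ℝ)) * ∑ t : Fin c.A, c.errorProb Q star m t

/-- The maximum over messages of the expected reaction delay averaged over the starting time. -/
def delay (Q : Channel X Y) (star : X) : ℝ :=
  ⨆ m : Fin c.M, (1 / (c.A : ℝ)) * ∑ t : Fin c.A, c.expectedDelay Q star m t

/-- The rate `ln M / delay`, which is `∞` if the delay vanishes. -/
def rate (Q : Channel X Y) (star : X) : ℝ≥0∞ :=
  ENNReal.ofReal (Real.log c.M) / ENNReal.ofReal (c.delay Q star)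

end AsyncCode

/-- The pair `(R, α)` is achievable: some sequence of codes has asynchronism levels
`A_n = e^{(α - o(1)) n}` (with `o(1) ≥ 0`), rates at least `R - o(1)` and maximum error
probabilities `o(1)`. -/
def Achievable (Q : Channel X Y) (star : X) (R α : ℝ≥0) : Prop :=
  ∃ c : ∀ n : ℕ, AsyncCode X Y n, ∀ ε : ℝ, 0 < ε → ∀ᶠ n : ℕ in Filter.atTop,
    (Real.exp (((α : ℝ) - ε) * n) ≤ (c n).A ∧ ((c n).A : ℝ) ≤ Real.exp ((α : ℝ) * n)) ∧
    ENNReal.ofReal ((R : ℝ) - ε) ≤ (c n).rate Q star ∧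
    (c n).maxError Q star ≤ ε

/-- The asynchronous capacity `α(R)`: the supremum (possibly `∞`) of the asynchronism exponents
achievable at rate `R`. -/
def asyncCapacity (Q : Channel X Y) (star : X) (R : ℝ≥0) : ℝ≥0∞ :=
  sSup ((fun α : ℝ≥0 => (α : ℝ≥0∞)) '' {α | Achievable Q star R α})

end Asynchronous

end AsyncComm

end

open AsyncComm

noncomputable section

/-! Rate is counted against the reaction delay and not against the length `n`, so a code word may
carry its message in a short initial part and use nearly all its length for a tail that is rarely
needed. This is why the exponent does not depend on the rate.

Achievability (`eventually_exists_meets`). Some letter `x` can produce an output that is impossible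
under noise, a hit. A code word is a preamble of constant length with `x` at the powers of two, then
a word of a synchronous block code of length about `γ n`, then a tail whose type is close to a good
`P`. The receiver stops a fixed time after the first hit. Noise makes no hits, and two hits at
powers of two locate the start of the code word (`SyncAt.unique`), so the block can be decoded with
a delay close to its length. The preamble fails with a probability that is small but constant, which
alone would cost a delay of order `A`. The tail prevents this: the receiver also stops if a
likelihood ratio test recognizes the tail while no hit has occurred. By the method of types
(`sum_min_memoryless_le`) the total error of this test is about `exp (-b B)` for any `b < min_W max
{...}`. With `b > α` and `B` close to `n`, this outweighs all `A` positions, for false alarms as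
well as for misses, and a failed preamble costs only a delay of order `n`.

Converse (`not_achievable_of_alphaBar_lt`). If `α > alphaBar`, each code word has a `W` at
divergence at most `β < α` per letter from both `Q` and the noise. The truncated density `g` of `W`
with respect to noise is at most `G = exp (n (β + δ))`, and the `g`-weighted noise is at most `G`
times the law of the transmission (`exists_confusing_density`). Since `A` is far larger than `n G`,
the sum of `g` over all windows of pure noise concentrates (second moments). A reliable decoder must
often let noise pass up to time `2T`, with `T` about `A / 3` (`error_ge`). A change of measure turns
this into late stopping for true transmissions that start before `T` (`le_delay`), so the delay is
at least of order `A / G`, which is exponential in `n`. A positive rate allows only a linear delay.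
-/

namespace AsyncComm

set_option linter.unusedSectionVars false

/-! ### Expectations under product laws. -/

section ProductExpectation

variable {I J Y : Type*} [Fintype I] [DecidableEq I] [Fintype J] [DecidableEq J] [Fintype Y]

/-- Expectation of `f` when the coordinates are independent with laws `μ i`. -/
def prodE (μ : I → ProbDist Y) (f : (I → Y) → ℝ) : ℝ :=
  ∑ y, (∏ i, (μ i).1 (y i)) * f y

lemma prodWeight_nonneg (μ : I → ProbDist Y) (y : I → Y) : 0 ≤ ∏ i, (μ i).1 (y i) :=
  Finset.prod_nonneg fun i _ => (μ i).2.1 _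

/-- Restricting to outputs of positive probability is what later expresses that noise never produces
a hit. -/
lemma prodE_mono_of_support (μ : I → ProbDist Y) {f g : (I → Y) → ℝ}
    (h : ∀ y, (∀ i, (μ i).1 (y i) ≠ 0) → f y ≤ g y) : prodE μ f ≤ prodE μ g := by
  refine Finset.sum_le_sum fun y _ => ?_
  by_cases hy : ∏ i, (μ i).1 (y i) = 0
  · simp [hy]
  · exact mul_le_mul_of_nonneg_left (h y fun i hi => hy (Finset.prod_eq_zero (Finset.mem_univ i) hi))
      (prodWeight_nonneg μ y)

lemma prodE_mono (μ : I → ProbDist Y) {f g : (I → Y) → ℝ} (h : ∀ y, f y ≤ g y) :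
    prodE μ f ≤ prodE μ g :=
  prodE_mono_of_support μ fun y _ => h y

lemma prodE_nonneg (μ : I → ProbDist Y) {f : (I → Y) → ℝ} (h : ∀ y, 0 ≤ f y) : 0 ≤ prodE μ f :=
  Finset.sum_nonneg fun y _ => mul_nonneg (prodWeight_nonneg μ y) (h y)

lemma prodE_const (μ : I → ProbDist Y) (c : ℝ) : prodE μ (fun _ => c) = c := by
  classical
  unfold prodE
  rw [← Finset.sum_mul]
  have h := Finset.prod_univ_sum (fun _ : I => (Finset.univ : Finset Y)) (fun i y => (μ i).1 y)
  rw [Fintype.piFinset_univ] at h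
  rw [← h]
  simp [(μ _).2.2]

lemma prodE_add (μ : I → ProbDist Y) (f g : (I → Y) → ℝ) :
    prodE μ (fun y => f y + g y) = prodE μ f + prodE μ g := by
  simp [prodE, mul_add, Finset.sum_add_distrib]

lemma prodE_sub (μ : I → ProbDist Y) (f g : (I → Y) → ℝ) :
    prodE μ (fun y => f y - g y) = prodE μ f - prodE μ g := by
  simp [prodE, mul_sub, Finset.sum_sub_distrib]

lemma prodE_const_mul (μ : I → ProbDist Y) (c : ℝ) (f : (I → Y) → ℝ) :
    prodE μ (fun y => c * f y) = c * prodE μ f := by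
  simp only [prodE, Finset.mul_sum]
  exact Finset.sum_congr rfl fun y _ => by ring

lemma prodE_finset_sum {K : Type*} (μ : I → ProbDist Y) (s : Finset K) (f : K → (I → Y) → ℝ) :
    prodE μ (fun y => ∑ k ∈ s, f k y) = ∑ k ∈ s, prodE μ (f k) := by
  simp only [prodE, Finset.mul_sum]
  exact Finset.sum_comm

/-- Marginalization: a function of the coordinates in the range of `e` only sees their laws. -/
lemma prodE_comp (μ : I → ProbDist Y) {e : J → I} (he : Function.Injective e)
    (F : (J → Y) → ℝ) :
    prodE μ (fun y => F (fun j => y (e j))) = prodE (fun j => μ (e j)) F := by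
  classical
  unfold prodE
  rw [← Finset.sum_fiberwise Finset.univ (fun y : I → Y => fun j => y (e j))]
  refine Finset.sum_congr rfl fun z _ => ?_
  have h1 : ∀ y ∈ Finset.univ.filter (fun y : I → Y => (fun j => y (e j)) = z),
      (∏ i, (μ i).1 (y i)) * F (fun j => y (e j)) = (∏ i, (μ i).1 (y i)) * F z := by
    intro y hy
    rw [(Finset.mem_filter.1 hy).2]
  rw [Finset.sum_congr rfl h1, ← Finset.sum_mul, Finset.sum_filter]
  congr 1
  -- The constraint that defines a fibre factors over the coordinates, so the sum over a fibre
  -- becomes a product of one-letter sums; the factors outside the range of `e` are total masses.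
  have h2 : ∀ y : I → Y, (if (fun j => y (e j)) = z then ∏ i, (μ i).1 (y i) else 0) =
      ∏ i, (if ∀ j, e j = i → y i = z j then (μ i).1 (y i) else 0) := by
    intro y
    split_ifs with h
    · refine Finset.prod_congr rfl fun i _ => ?_
      rw [if_pos]
      rintro j rfl
      exact congrFun h j
    · obtain ⟨j, hj⟩ : ∃ j, y (e j) ≠ z j := by
        by_contra hc
        push Not at hc
        exact h (funext hc)
      refine (Finset.prod_eq_zero (Finset.mem_univ (e j)) ?_).symm
      rw [if_neg]
      intro hc
      exact hj (hc j rfl)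
  rw [Finset.sum_congr rfl fun y _ => h2 y]
  have h3 := Finset.prod_univ_sum (fun _ : I => (Finset.univ : Finset Y))
    (fun i y => if ∀ j, e j = i → y = z j then (μ i).1 y else 0)
  rw [Fintype.piFinset_univ] at h3
  rw [← h3]
  refine (Fintype.prod_of_injective e he _ _ ?_ ?_).symm
  · intro i hi
    rw [← (μ i).2.2]
    refine Finset.sum_congr rfl fun y _ => ?_
    rw [if_pos]
    intro j hj
    exact absurd ⟨j, hj⟩ hi
  · intro j
    have h4 : ∀ y : Y, (∀ j', e j' = e j → y = z j') ↔ y = z j := by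
      intro y
      refine ⟨fun h => h j rfl, fun h j' hj' => ?_⟩
      rw [he hj', h]
    simp [h4]

/-- Functions of disjoint sets of coordinates are uncorrelated. -/
lemma prodE_mul_of_disjoint {K : Type*} [Fintype K] [DecidableEq K] (μ : I → ProbDist Y)
    {e : J → I} {e' : K → I} (he : Function.Injective e) (he' : Function.Injective e')
    (hd : ∀ j k, e j ≠ e' k) (F : (J → Y) → ℝ) (G : (K → Y) → ℝ) :
    prodE μ (fun y => F (fun j => y (e j)) * G (fun k => y (e' k))) =
      prodE (fun j => μ (e j)) F * prodE (fun k => μ (e' k)) G := by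
  have hi : Function.Injective (Sum.elim e e') := he.sumElim he' hd
  have h := prodE_comp μ hi (fun z => F (fun j => z (Sum.inl j)) * G (fun k => z (Sum.inr k)))
  simp only [Sum.elim_inl, Sum.elim_inr] at h
  rw [h]
  unfold prodE
  rw [Finset.sum_mul_sum, ← Finset.sum_product', Finset.univ_product_univ]
  refine Fintype.sum_equiv (Equiv.sumArrowEquivProdArrow J K Y) _ _ fun z => ?_
  simp only [Fintype.prod_sum_type, Sum.elim_inl, Sum.elim_inr, Equiv.sumArrowEquivProdArrow,
    Equiv.coe_fn_mk]
  simp only [Function.comp_def]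
  ring

/-- The variance of `|f|` is nonnegative. -/
lemma prodE_abs_le_sqrt (μ : I → ProbDist Y) (f : (I → Y) → ℝ) :
    prodE μ (fun y => |f y|) ≤ Real.sqrt (prodE μ fun y => f y ^ 2) := by
  refine Real.le_sqrt_of_sq_le ?_
  have h : 0 ≤ prodE μ (fun y => (|f y| - prodE μ (fun y => |f y|)) ^ 2) :=
    prodE_nonneg μ fun y => sq_nonneg _
  have h2 : prodE μ (fun y => (|f y| - prodE μ (fun y => |f y|)) ^ 2) =
      prodE μ (fun y => f y ^ 2) - (prodE μ (fun y => |f y|)) ^ 2 := by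
    set a := prodE μ (fun y => |f y|) with ha
    have : (fun y => (|f y| - a) ^ 2) = fun y => (f y ^ 2 - (2 * a) * |f y|) + a ^ 2 := by
      funext y
      rw [sub_sq, sq_abs]
      ring
    rw [this, prodE_add, prodE_sub, prodE_const_mul, prodE_const, ← ha]
    ring
  linarith

end ProductExpectation

/-! ### Attainment of the minima and of the maximum. -/

section Attainment

variable {X Y : Type*} [Fintype X] [Fintype Y]

lemma continuous_mul_log_div (q : ℝ) : Continuous fun p : ℝ => p * Real.log (p / q) := by
  by_cases hq : q = 0
  · simpa [hq] using continuous_const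
  · have h : (fun p : ℝ => p * Real.log (p / q)) =
        fun p : ℝ => q * ((p / q) * Real.log (p / q)) := by
      funext p
      field_simp
    rw [h]
    exact continuous_const.mul (Real.continuous_mul_log.comp (continuous_id.div_const q))

lemma continuous_coord (y : Y) : Continuous fun p : ProbDist Y => p.1 y :=
  (continuous_apply y).comp continuous_subtype_val

/-- A finite sublevel set is the intersection of the closed condition `p ≪ q` with a sublevel set of
a continuous real function. -/
lemma lowerSemicontinuous_kl (q : ProbDist Y) : LowerSemicontinuous fun p => kl p q := by
  rw [lowerSemicontinuous_iff_isClosed_preimage]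
  intro c
  by_cases hc : c = ⊤
  · simp [hc]
  have h : (fun p => kl p q) ⁻¹' Set.Iic c = {p : ProbDist Y | ∀ y, q.1 y = 0 → p.1 y = 0} ∩
      {p : ProbDist Y | ENNReal.ofReal (∑ y, p.1 y * Real.log (p.1 y / q.1 y)) ≤ c} := by
    ext p
    simp only [Set.mem_preimage, Set.mem_Iic, Set.mem_inter_iff, Set.mem_ofPred_eq, kl]
    split_ifs with hp
    · exact ⟨fun h => ⟨hp, h⟩, fun h => h.2⟩
    · simp [hp, hc]
  rw [h]
  refine IsClosed.inter ?_ ?_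
  · simp only [Set.ofPred_forall]
    refine isClosed_iInter fun y => isClosed_iInter fun _ => ?_
    exact isClosed_eq (continuous_coord y) continuous_const
  · refine isClosed_le (ENNReal.continuous_ofReal.comp ?_) continuous_const
    exact continuous_finsetSum _ fun y _ =>
      (continuous_mul_log_div (q.1 y)).comp (continuous_coord y)

lemma lowerSemicontinuous_condKL (V : Channel X Y) (P : ProbDist X) :
    LowerSemicontinuous fun W => condKL W V P := by
  unfold condKL
  refine lowerSemicontinuous_sum fun x _ => ?_
  have h : LowerSemicontinuous fun W : Channel X Y => kl (W x) (V x) :=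
    (lowerSemicontinuous_kl (V x)).comp (continuous_apply x)
  exact (ENNReal.continuous_const_mul ENNReal.ofReal_ne_top).comp_lowerSemicontinuous h
    fun a b hab => mul_le_mul_right hab _

theorem exists_maxDiv_eq_iInf (Q : Channel X Y) (star : X) (P : ProbDist X) :
    ∃ W : Channel X Y, maxDiv Q star P W = ⨅ W' : Channel X Y, maxDiv Q star P W' := by
  have h : LowerSemicontinuous fun W => maxDiv Q star P W :=
    (lowerSemicontinuous_condKL Q P).sup (lowerSemicontinuous_condKL (fun _ => Q star) P)
  obtain ⟨W, -, hW⟩ := (h.lowerSemicontinuousOn Set.univ).exists_isMinOn ⟨Q, Set.mem_univ _⟩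
    isCompact_univ
  exact ⟨W, le_antisymm (le_iInf fun W' => hW (Set.mem_univ W')) (iInf_le _ W)⟩

/-- The point mass at `x`. -/
def pointMass {S : Type*} [Fintype S] [DecidableEq S] (x : S) : ProbDist S :=
  ⟨Pi.single x 1, single_mem_stdSimplex ℝ x⟩

lemma condKL_pointMass [DecidableEq X] (W V : Channel X Y) (x : X) :
    condKL W V (pointMass x) = kl (W x) (V x) := by
  unfold condKL pointMass
  rw [Finset.sum_eq_single x]
  · simp
  · intro x' _ hx'
    simp [hx']
  · simp

lemma continuous_condKL_of_finite (W V : Channel X Y) (h : ∀ x, kl (W x) (V x) ≠ ⊤) :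
    Continuous fun P : ProbDist X => condKL W V P := by
  unfold condKL
  refine continuous_finsetSum _ fun x _ => ?_
  exact (ENNReal.continuous_mul_const (h x)).comp
    (ENNReal.continuous_ofReal.comp (continuous_coord x))

/-- If for some letter no output law is at finite divergence from both `Q x` and the noise, the
point mass there already gives `∞`. Otherwise the infimum may be restricted to channels with all
divergences finite; for these the objective is continuous in `P`, so the infimum is upper
semicontinuous on a compact set. -/
theorem exists_iInf_maxDiv_eq_alphaBar (Q : Channel X Y) (star : X) :
    ∃ P : ProbDist X, (⨅ W : Channel X Y, maxDiv Q star P W) = alphaBar Q star := by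
  classical
  by_cases hx : ∃ x, ∀ p : ProbDist Y, max (kl p (Q x)) (kl p (Q star)) = ⊤
  · obtain ⟨x, hx⟩ := hx
    refine ⟨pointMass x, ?_⟩
    have h1 : (⨅ W : Channel X Y, maxDiv Q star (pointMass x) W) = ⊤ := by
      refine iInf_eq_top.2 fun W => ?_
      rw [maxDiv, condKL_pointMass, condKL_pointMass]
      exact hx (W x)
    rw [h1]
    exact (top_le_iff.1 (h1 ▸ le_iSup
      (fun P : ProbDist X => ⨅ W : Channel X Y, maxDiv Q star P W) (pointMass x))).symm
  · push Not at hx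
    choose W0 hW0 using hx
    let Fin' : Channel X Y → Prop := fun W =>
      (∀ x, kl (W x) (Q x) ≠ ⊤) ∧ ∀ x, kl (W x) (Q star) ≠ ⊤
    have key : ∀ P : ProbDist X, (⨅ W : Channel X Y, maxDiv Q star P W) =
        ⨅ (W : Channel X Y) (_ : Fin' W), maxDiv Q star P W := by
      intro P
      refine le_antisymm (le_iInf₂ fun W _ => iInf_le _ W) (le_iInf fun W => ?_)
      by_cases hW : maxDiv Q star P W = ⊤
      · simp [hW]
      have hW1 : condKL W Q P ≠ ⊤ := fun h => hW (by simp [maxDiv, h])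
      have hW2 : condKL W (fun _ => Q star) P ≠ ⊤ := fun h => hW (by simp [maxDiv, h])
      have hfin : ∀ V : Channel X Y, condKL W V P ≠ ⊤ → ∀ x, P.1 x ≠ 0 → kl (W x) (V x) ≠ ⊤ := by
        intro V hV x hPx h
        refine hV (ENNReal.sum_eq_top.2 ⟨x, Finset.mem_univ x, ?_⟩)
        rw [h, ENNReal.mul_top]
        have := lt_of_le_of_ne (P.2.1 x) (Ne.symm hPx)
        simpa using this
      -- Because `0 * ∞ = 0`, changing `W` off the support of `P` leaves the objective unchanged,
      -- and `W0` makes the divergences finite there.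
      let W' : Channel X Y := fun x => if P.1 x = 0 then W0 x else W x
      have heq : ∀ V : Channel X Y, condKL W' V P = condKL W V P := by
        intro V
        refine Finset.sum_congr rfl fun x _ => ?_
        by_cases h : P.1 x = 0
        · simp [h]
        · simp [W', h]
      have hW' : Fin' W' := by
        refine ⟨fun x h' => ?_, fun x h' => ?_⟩
        · by_cases h : P.1 x = 0
          · exact hW0 x (by simp only [W', h, if_true] at h'; simp [h'])
          · exact hfin Q hW1 x h (by simpa [W', h] using h')
        · by_cases h : P.1 x = 0
          · exact hW0 x (by simp only [W', h, if_true] at h'; simp [h'])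
          · exact hfin (fun _ => Q star) hW2 x h (by simpa [W', h] using h')
      refine (iInf₂_le W' hW').trans (le_of_eq ?_)
      simp only [maxDiv, heq]
    have husc : UpperSemicontinuous fun P : ProbDist X =>
        ⨅ (W : Channel X Y) (_ : Fin' W), maxDiv Q star P W := by
      refine upperSemicontinuous_biInf fun W hW => Continuous.upperSemicontinuous ?_
      exact (continuous_condKL_of_finite W Q hW.1).max
        (continuous_condKL_of_finite W (fun _ => Q star) hW.2)
    obtain ⟨P, -, hP⟩ := (husc.upperSemicontinuousOn Set.univ).exists_isMaxOn
      ⟨pointMass star, Set.mem_univ _⟩ isCompact_univ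
    refine ⟨P, le_antisymm (le_iSup
      (fun P : ProbDist X => ⨅ W : Channel X Y, maxDiv Q star P W) P) (iSup_le fun P' => ?_)⟩
    rw [key, key]
    exact hP (Set.mem_univ P')

end Attainment

/-! ### The method of types for the likelihood ratio test. -/

section Types

variable {X Y : Type*} [Fintype Y]

/-- The real-valued expression for the divergence, meaningful when `p ≪ q`. -/
def klReal (p q : ProbDist Y) : ℝ := ∑ y, p.1 y * Real.log (p.1 y / q.1 y)

lemma kl_of_ac {p q : ProbDist Y} (h : ∀ y, q.1 y = 0 → p.1 y = 0) :
    kl p q = ENNReal.ofReal (klReal p q) := if_pos h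

lemma ac_of_kl_ne_top {p q : ProbDist Y} (h : kl p q ≠ ⊤) : ∀ y, q.1 y = 0 → p.1 y = 0 := by
  by_contra hc
  exact h (if_neg hc)

lemma klReal_nonneg {p q : ProbDist Y} (h : ∀ y, q.1 y = 0 → p.1 y = 0) : 0 ≤ klReal p q := by
  have h1 : ∀ y, p.1 y - q.1 y ≤ p.1 y * Real.log (p.1 y / q.1 y) := by
    intro y
    rcases (p.2.1 y).eq_or_lt with hp | hp
    · rw [← hp]
      simpa using q.2.1 y
    · have hq : 0 < q.1 y := lt_of_le_of_ne (q.2.1 y) fun h0 => hp.ne' (h y h0.symm)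
      have h2 := Real.log_le_sub_one_of_pos (div_pos hq hp)
      have h3 : Real.log (p.1 y / q.1 y) = - Real.log (q.1 y / p.1 y) := by
        rw [← Real.log_inv, inv_div]
      rw [h3]
      have h4 : p.1 y * Real.log (q.1 y / p.1 y) ≤ p.1 y * (q.1 y / p.1 y - 1) :=
        mul_le_mul_of_nonneg_left h2 hp.le
      have h5 : p.1 y * (q.1 y / p.1 y - 1) = q.1 y - p.1 y := by
        field_simp
      linarith
  calc (0 : ℝ) = ∑ y, (p.1 y - q.1 y) := by rw [Finset.sum_sub_distrib, p.2.2, q.2.2, sub_self]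
    _ ≤ _ := Finset.sum_le_sum fun y _ => h1 y

lemma memoryless_nonneg (Q : Channel X Y) {N : ℕ} (x : Fin N → X) (y : Fin N → Y) :
    0 ≤ memoryless Q x y := Finset.prod_nonneg fun i _ => (Q (x i)).2.1 _

lemma sum_memoryless (Q : Channel X Y) {N : ℕ} (x : Fin N → X) :
    ∑ y, memoryless Q x y = 1 := by
  have := prodE_const (fun i => Q (x i)) 1
  simpa [prodE, memoryless] using this

variable {B : ℕ}

open Classical in
/-- The joint type of the words `w` and `z`. -/
def jointCount (w : Fin B → X) (z : Fin B → Y) (x : X) (y : Y) : ℕ :=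
  (Finset.univ.filter fun j => w j = x ∧ z j = y).card

lemma jointCount_le (w : Fin B → X) (z : Fin B → Y) (x : X) (y : Y) :
    jointCount w z x y ≤ B := by
  classical
  exact (Finset.card_filter_le _ _).trans (by simp)

lemma jointCount_pos (w : Fin B → X) (z : Fin B → Y) (j : Fin B) :
    0 < jointCount w z (w j) (z j) :=
  Finset.card_pos.2 ⟨j, by simp⟩

lemma exists_of_jointCount_pos {w : Fin B → X} {z : Fin B → Y} {x : X} {y : Y}
    (h : 0 < jointCount w z x y) : ∃ j, w j = x ∧ z j = y := by
  obtain ⟨j, hj⟩ := Finset.card_pos.1 h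
  exact ⟨j, by simpa using hj⟩

lemma sum_jointCount_mul [Fintype X] (w : Fin B → X) (z : Fin B → Y) (h : X → Y → ℝ) :
    ∑ x, ∑ y, (jointCount w z x y : ℝ) * h x y = ∑ j, h (w j) (z j) := by
  classical
  have h1 : ∀ j, h (w j) (z j) = ∑ x, ∑ y, if w j = x ∧ z j = y then h x y else 0 := by
    intro j
    rw [Finset.sum_eq_single (w j), Finset.sum_eq_single (z j)]
    · simp
    · intro y _ hy
      simp [Ne.symm hy]
    · simp
    · intro x _ hx
      simp [Ne.symm hx]
    · simp
  simp only [h1]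
  rw [Finset.sum_comm (s := (Finset.univ : Finset (Fin B)))]
  refine Finset.sum_congr rfl fun x _ => ?_
  rw [Finset.sum_comm (s := (Finset.univ : Finset (Fin B)))]
  refine Finset.sum_congr rfl fun y _ => ?_
  rw [← Finset.sum_filter, Finset.sum_const, nsmul_eq_mul]
  rfl

/-- The empirical conditional distribution of `z` given `w`. -/
lemma exists_condType (V : Channel X Y) (w : Fin B → X) (z : Fin B → Y) :
    ∃ W : Channel X Y, ∀ j y,
      (∑ y', (jointCount w z (w j) y' : ℝ)) * (W (w j)).1 y = jointCount w z (w j) y := by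
  classical
  have h : ∀ x, ∃ p : ProbDist Y, (∃ j, w j = x) → ∀ y,
      (∑ y', (jointCount w z x y' : ℝ)) * p.1 y = jointCount w z x y := by
    intro x
    by_cases hx : ∃ j, w j = x
    · obtain ⟨j, hj⟩ := hx
      have hpos : 0 < ∑ y', (jointCount w z x y' : ℝ) := by
        refine Finset.sum_pos' (fun y _ => Nat.cast_nonneg _) ⟨z j, Finset.mem_univ _, ?_⟩
        subst hj
        exact_mod_cast jointCount_pos w z j
      refine ⟨⟨fun y => jointCount w z x y / ∑ y', (jointCount w z x y' : ℝ),
        fun y => by positivity, ?_⟩, fun _ y => ?_⟩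
      · rw [← Finset.sum_div, div_self hpos.ne']
      · simp only
        field_simp
    · exact ⟨V x, fun h => absurd h hx⟩
  choose W hW using h
  exact ⟨W, fun j y => hW (w j) ⟨j, rfl⟩ y⟩

/-- Averaging under the conditional type is averaging along the words. With a log-likelihood ratio
for `h`, this makes the divergence equal to the realized log-likelihood ratio. -/
lemma sum_condType_mul [Fintype X] {w : Fin B → X} {z : Fin B → Y} {W : Channel X Y}
    (hW : ∀ j y,
      (∑ y', (jointCount w z (w j) y' : ℝ)) * (W (w j)).1 y = jointCount w z (w j) y)
    (h : X → Y → ℝ) :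
    ∑ j, ∑ y, (W (w j)).1 y * h (w j) y = ∑ j, h (w j) (z j) := by
  rw [← sum_jointCount_mul w z h, ← sum_jointCount_mul w z fun x _ => ∑ y, (W x).1 y * h x y]
  refine Finset.sum_congr rfl fun x _ => ?_
  by_cases hx : ∃ j, w j = x
  · obtain ⟨j, rfl⟩ := hx
    rw [← Finset.sum_mul, Finset.mul_sum]
    refine Finset.sum_congr rfl fun y _ => ?_
    rw [← mul_assoc, hW]
  · have h0 : ∀ y, jointCount w z x y = 0 := by
      intro y
      by_contra hc
      obtain ⟨j, hj, -⟩ := exists_of_jointCount_pos (Nat.pos_of_ne_zero hc)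
      exact hx ⟨j, hj⟩
    simp [h0]

/-- The probability of a word whose conditional type is `W` decays at the rate `D(W‖V)`. -/
lemma memoryless_le_of_condType [Fintype X] {w : Fin B → X} {z : Fin B → Y} {W : Channel X Y}
    (hW : ∀ j y,
      (∑ y', (jointCount w z (w j) y' : ℝ)) * (W (w j)).1 y = jointCount w z (w j) y)
    (V : Channel X Y) {β : ℝ} (hβ : ENNReal.ofReal β ≤ ∑ j, kl (W (w j)) (V (w j))) :
    memoryless V w z ≤ memoryless W w z * Real.exp (-β) := by
  -- If a divergence is infinite, `W` charges a letter that `V` forbids; as `W` is empirical, this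
  -- letter pair occurs in the words, so `z` has probability zero under `V`.
  by_cases htop : ∃ j, kl (W (w j)) (V (w j)) = ⊤
  · obtain ⟨j, hj⟩ := htop
    have : ¬ ∀ y, (V (w j)).1 y = 0 → (W (w j)).1 y = 0 := by
      intro hac
      rw [kl_of_ac hac] at hj
      exact ENNReal.ofReal_ne_top hj
    push Not at this
    obtain ⟨y, hVy, hWy⟩ := this
    have hc : 0 < jointCount w z (w j) y := by
      rw [Nat.pos_iff_ne_zero]
      intro h0
      have h1 := hW j y
      rw [h0, Nat.cast_zero, mul_eq_zero, or_iff_left hWy] at h1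
      have h2 : (jointCount w z (w j) (z j) : ℝ) ≤ 0 := by
        rw [← h1]
        exact Finset.single_le_sum (f := fun y' => (jointCount w z (w j) y' : ℝ))
          (fun y' _ => Nat.cast_nonneg _) (Finset.mem_univ (z j))
      have h3 := jointCount_pos w z j
      have : (0 : ℝ) < jointCount w z (w j) (z j) := by exact_mod_cast h3
      linarith
    obtain ⟨j', hj', hz⟩ := exists_of_jointCount_pos hc
    have : memoryless V w z = 0 :=
      Finset.prod_eq_zero (Finset.mem_univ j') (by rw [hj', hz, hVy])
    rw [this]
    exact mul_nonneg (memoryless_nonneg _ _ _) (Real.exp_pos _).le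
  · push Not at htop
    have hac := fun j => ac_of_kl_ne_top (htop j)
    rw [Finset.sum_congr rfl fun j _ => kl_of_ac (hac j),
      ← ENNReal.ofReal_sum_of_nonneg fun j _ => klReal_nonneg (hac j),
      ENNReal.ofReal_le_ofReal_iff (Finset.sum_nonneg fun j _ => klReal_nonneg (hac j))] at hβ
    unfold klReal at hβ
    rw [sum_condType_mul hW fun x y => Real.log ((W x).1 y / (V x).1 y)] at hβ
    have hWpos : ∀ j, 0 < (W (w j)).1 (z j) := by
      intro j
      refine lt_of_le_of_ne ((W (w j)).2.1 _) fun h0 => ?_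
      have h1 := hW j (z j)
      rw [← h0, mul_zero] at h1
      exact (jointCount_pos w z j).ne (by exact_mod_cast h1)
    have hVpos : ∀ j, 0 < (V (w j)).1 (z j) := fun j =>
      lt_of_le_of_ne ((V (w j)).2.1 _) fun h0 => (hWpos j).ne' (hac j _ h0.symm)
    have hexp : Real.exp β ≤ memoryless W w z / memoryless V w z := by
      calc Real.exp β ≤ Real.exp (∑ j, Real.log ((W (w j)).1 (z j) / (V (w j)).1 (z j))) :=
            Real.exp_le_exp.2 hβ
        _ = ∏ j, ((W (w j)).1 (z j) / (V (w j)).1 (z j)) := by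
            rw [Real.exp_sum]
            exact Finset.prod_congr rfl fun j _ => Real.exp_log (div_pos (hWpos j) (hVpos j))
        _ = _ := Finset.prod_div_distrib _ _
    have hV0 : 0 < memoryless V w z := Finset.prod_pos fun j _ => hVpos j
    rw [le_div_iff₀ hV0] at hexp
    rw [Real.exp_neg, ← div_eq_mul_inv, le_div_iff₀ (Real.exp_pos _)]
    linarith

/-- Bound on the total error of the likelihood ratio test between the words `w` sent over the
channels `Q` and `V`, by the method of types. -/
theorem sum_min_memoryless_le [Fintype X] (Q V : Channel X Y) (w : Fin B → X) {β : ℝ}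
    (h : ∀ W : Channel X Y, ENNReal.ofReal β ≤
      max (∑ j, kl (W (w j)) (Q (w j))) (∑ j, kl (W (w j)) (V (w j)))) :
    ∑ z, min (memoryless Q w z) (memoryless V w z) ≤
      ((B : ℝ) + 1) ^ (Fintype.card X * Fintype.card Y) * Real.exp (-β) := by
  classical
  -- There are at most `(B + 1) ^ (|X| |Y|)` joint types. Words of one type share one `W`, under
  -- which their total probability is at most one.
  let T : (Fin B → Y) → (X → Y → Fin (B + 1)) := fun z x y =>
    ⟨jointCount w z x y, Nat.lt_succ_of_le (jointCount_le w z x y)⟩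
  rw [← Finset.sum_fiberwise Finset.univ T]
  have hfib : ∀ τ : X → Y → Fin (B + 1),
      ∑ z ∈ Finset.univ.filter (fun z => T z = τ), min (memoryless Q w z) (memoryless V w z) ≤
        Real.exp (-β) := by
    intro τ
    by_cases hne : ∃ z0, T z0 = τ
    · obtain ⟨z0, hz0⟩ := hne
      obtain ⟨W, hW⟩ := exists_condType Q w z0
      have hz : ∀ z ∈ Finset.univ.filter (fun z => T z = τ),
          min (memoryless Q w z) (memoryless V w z) ≤ memoryless W w z * Real.exp (-β) := by
        intro z hz
        have hTz : T z = T z0 := (Finset.mem_filter.1 hz).2.trans hz0.symm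
        have hcount : ∀ x y, jointCount w z x y = jointCount w z0 x y := fun x y =>
          congrArg Fin.val (congrFun (congrFun hTz x) y)
        have hW' : ∀ j y,
            (∑ y', (jointCount w z (w j) y' : ℝ)) * (W (w j)).1 y = jointCount w z (w j) y := by
          intro j y
          simp only [hcount]
          exact hW j y
        rcases le_max_iff.1 (h W) with h1 | h1
        · exact (min_le_left _ _).trans (memoryless_le_of_condType hW' Q h1)
        · exact (min_le_right _ _).trans (memoryless_le_of_condType hW' V h1)
      refine (Finset.sum_le_sum hz).trans ?_
      rw [← Finset.sum_mul]
      refine mul_le_of_le_one_left (Real.exp_pos _).le ?_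
      rw [← sum_memoryless W w]
      exact Finset.sum_le_sum_of_subset_of_nonneg (Finset.filter_subset _ _)
        fun z _ _ => memoryless_nonneg W w z
    · have : Finset.univ.filter (fun z => T z = τ) = ∅ := by
        rw [Finset.filter_eq_empty_iff]
        exact fun z _ hz => hne ⟨z, hz⟩
      rw [this, Finset.sum_empty]
      exact (Real.exp_pos _).le
  refine (Finset.sum_le_sum fun τ _ => hfib τ).trans (le_of_eq ?_)
  rw [Finset.sum_const, nsmul_eq_mul, Finset.card_univ]
  simp [pow_mul']

end Types

/-! ### Tail words with a prescribed type. -/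

section TailWord

variable {X : Type*} [Fintype X]

/-- There is a word of length `B` in which each `x` occurs at least `⌊B P(x)⌋` times. -/
lemma exists_word_count_ge [DecidableEq X] (P : ProbDist X) (star : X) (B : ℕ) :
    ∃ w : Fin B → X, ∀ x,
      ⌊(B : ℝ) * P.1 x⌋₊ ≤ (Finset.univ.filter fun j => w j = x).card := by
  let m : X → ℕ := fun x => ⌊(B : ℝ) * P.1 x⌋₊
  have hcard : Fintype.card (Σ x, Fin (m x)) ≤ Fintype.card (Fin B) := by
    rw [Fintype.card_sigma, Fintype.card_fin]
    simp only [Fintype.card_fin]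
    have : ((∑ x, m x : ℕ) : ℝ) ≤ B := by
      push_cast
      calc ∑ x, (m x : ℝ) ≤ ∑ x, (B : ℝ) * P.1 x := Finset.sum_le_sum fun x _ =>
            Nat.floor_le (mul_nonneg (Nat.cast_nonneg _) (P.2.1 x))
        _ = B := by rw [← Finset.mul_sum, P.2.2, mul_one]
    exact_mod_cast this
  obtain ⟨e⟩ := Function.Embedding.nonempty_of_card_le hcard
  let w : Fin B → X := Function.extend e Sigma.fst fun _ => star
  refine ⟨w, fun x => ?_⟩
  have : (Finset.univ.image fun i : Fin (m x) => e ⟨x, i⟩) ⊆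
      Finset.univ.filter fun j => w j = x := by
    intro j hj
    obtain ⟨i, -, rfl⟩ := Finset.mem_image.1 hj
    simp [w, e.injective.extend_apply]
  refine le_trans (le_of_eq ?_) (Finset.card_le_card this)
  rw [Finset.card_image_of_injective, Finset.card_univ, Fintype.card_fin]
  intro i i' h
  simpa using e.injective h

/-- For any `b < min_W max{…}` and long enough words of type close to `P`, the divergences of any
`W` cannot both be smaller than `b` per letter. -/
theorem exists_word_maxDiv_ge {Y : Type*} [Fintype Y] (Q : Channel X Y) (star : X)
    (P : ProbDist X) {b : ℝ} (hb0 : 0 ≤ b)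
    (hb : ENNReal.ofReal b < ⨅ W : Channel X Y, maxDiv Q star P W) :
    ∃ B0 : ℕ, ∀ B : ℕ, B0 ≤ B → ∃ w : Fin B → X, ∀ W : Channel X Y,
      ENNReal.ofReal (b * B) ≤
        max (∑ j, kl (W (w j)) (Q (w j))) (∑ j, kl (W (w j)) (Q star)) := by
  classical
  obtain ⟨b', hb'0, hbb', hb'⟩ := ENNReal.lt_iff_exists_real_btwn.1 hb
  have hbb : b < b' := (ENNReal.ofReal_lt_ofReal_iff_of_nonneg hb0).1 hbb'
  have hb'pos : 0 < b' := hb0.trans_lt hbb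
  -- The gap between `b` and `b'` pays for the rounding: for large `B` each letter occurs at least
  -- `ρ B P(x)` times, and `ρ b' = b`.
  set ρ := b / b' with hρ
  have hρ1 : ρ < 1 := (div_lt_one hb'pos).2 hbb
  have hρ0 : 0 ≤ ρ := div_nonneg hb0 hb'pos.le
  have hev : ∀ᶠ B : ℕ in Filter.atTop, ∀ x, ρ * ((B : ℝ) * P.1 x) ≤ ⌊(B : ℝ) * P.1 x⌋₊ := by
    rw [Filter.eventually_all]
    intro x
    rcases (P.2.1 x).eq_or_lt with h0 | h0
    · exact Filter.Eventually.of_forall fun B => by rw [← h0]; simp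
    · have h1 : 0 < (1 - ρ) * P.1 x := mul_pos (by linarith) h0
      filter_upwards [Filter.eventually_ge_atTop ⌈1 / ((1 - ρ) * P.1 x)⌉₊] with B hB
      have h2 : 1 / ((1 - ρ) * P.1 x) ≤ B := Nat.ceil_le.1 hB
      rw [div_le_iff₀ h1] at h2
      have h3 := Nat.lt_floor_add_one ((B : ℝ) * P.1 x)
      nlinarith
  obtain ⟨B0, hB0⟩ := Filter.eventually_atTop.1 hev
  refine ⟨B0, fun B hB => ?_⟩
  obtain ⟨w, hw⟩ := exists_word_count_ge P star B
  refine ⟨w, fun W => ?_⟩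
  have hsum : ∀ V : Channel X Y,
      ENNReal.ofReal (ρ * B) * condKL W V P ≤ ∑ j, kl (W (w j)) (V (w j)) := by
    intro V
    have h1 : ∑ j, kl (W (w j)) (V (w j)) =
        ∑ x, ((Finset.univ.filter fun j => w j = x).card : ℝ≥0∞) * kl (W x) (V x) := by
      rw [← Finset.sum_fiberwise Finset.univ w]
      refine Finset.sum_congr rfl fun x _ => ?_
      rw [← nsmul_eq_mul, ← Finset.sum_const]
      refine Finset.sum_congr rfl fun j hj => ?_
      rw [(Finset.mem_filter.1 hj).2]
    rw [h1, condKL, Finset.mul_sum]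
    refine Finset.sum_le_sum fun x _ => ?_
    rw [← mul_assoc]
    refine mul_le_mul_left ?_ _
    rw [← ENNReal.ofReal_mul (by positivity), ← ENNReal.ofReal_natCast]
    refine ENNReal.ofReal_le_ofReal ?_
    have h2 := hB0 B hB x
    have h3 : ((⌊(B : ℝ) * P.1 x⌋₊ : ℕ) : ℝ) ≤ (Finset.univ.filter fun j => w j = x).card := by
      exact_mod_cast hw x
    linarith [mul_assoc ρ (B : ℝ) (P.1 x)]
  have hW : ENNReal.ofReal b' ≤ maxDiv Q star P W := hb'.le.trans (iInf_le _ W)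
  have hbB : ENNReal.ofReal (b * B) = ENNReal.ofReal (ρ * B) * ENNReal.ofReal b' := by
    rw [← ENNReal.ofReal_mul (by positivity)]
    congr 1
    rw [hρ]
    field_simp
  rw [hbB]
  rcases le_max_iff.1 hW with h | h
  · exact le_max_of_le_left ((mul_le_mul_right h _).trans (hsum Q))
  · exact le_max_of_le_right ((mul_le_mul_right h _).trans (hsum fun _ => Q star))

end TailWord

open Classical in
/-- The indicator of a proposition. -/
def ind (p : Prop) : ℝ := if p then 1 else 0

lemma ind_pos {p : Prop} (h : p) : ind p = 1 := if_pos h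

lemma ind_neg {p : Prop} (h : ¬ p) : ind p = 0 := if_neg h

lemma ind_nonneg (p : Prop) : 0 ≤ ind p := by
  unfold ind
  split_ifs <;> norm_num

lemma ind_le_one (p : Prop) : ind p ≤ 1 := by
  unfold ind
  split_ifs <;> norm_num

lemma mul_ind (p : Prop) {_ : Decidable p} (a : ℝ) : a * ind p = if p then a else 0 := by
  by_cases h : p
  · rw [ind_pos h, if_pos h, mul_one]
  · rw [ind_neg h, if_neg h, mul_zero]

/-! ### Codes given by a deterministic stopping rule. -/

section StopRule

variable {X Y : Type*} [Fintype Y]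

/-- The outputs up to the instant of index `k`, continued by the constant letter `y0`. -/
def observed {N : ℕ} (y0 : Y) (y : Fin N → Y) (k i : ℕ) : Y :=
  if h : i < N ∧ i ≤ k then y ⟨i, h.1⟩ else y0

lemma observed_congr {N : ℕ} {y0 : Y} {y y' : Fin N → Y} {k : Fin N}
    (h : ∀ j, j ≤ k → y j = y' j) : observed y0 y k = observed y0 y' k := by
  funext i
  unfold observed
  split_ifs with hi
  · exact h ⟨i, hi.1⟩ hi.2
  · rfl

/-- The rule `S`, forced to stop at the last instant. -/
def StopsAt {N : ℕ} (y0 : Y) (S : ℕ → (ℕ → Y) → Prop) (y : Fin N → Y) (k : Fin N) : Prop :=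
  S k (observed y0 y k) ∨ k.1 + 1 = N

lemma stopsAt_congr {N : ℕ} {y0 : Y} {S : ℕ → (ℕ → Y) → Prop} {y y' : Fin N → Y} {k : Fin N}
    (h : ∀ j, j ≤ k → y j = y' j) : StopsAt y0 S y k ↔ StopsAt y0 S y' k := by
  rw [StopsAt, StopsAt, observed_congr h]

lemma exists_stop_index {N : ℕ} (hN : 0 < N) (y0 : Y) (S : ℕ → (ℕ → Y) → Prop) (y : Fin N → Y) :
    ∃ τ, StopsAt y0 S y τ ∧ ∀ k, StopsAt y0 S y k → τ ≤ k := by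
  obtain ⟨τ, h1, h2⟩ := wellFounded_lt.has_min {k : Fin N | StopsAt y0 S y k}
    ⟨⟨N - 1, by omega⟩, Or.inr (by simp only; omega)⟩
  exact ⟨τ, h1, fun k hk => not_lt.1 (h2 k hk)⟩

open Classical in
/-- The probability of stopping at `k` for the deterministic rule `S`. -/
def stopRuleProb {N : ℕ} (y0 : Y) (S : ℕ → (ℕ → Y) → Prop) (k : Fin N) (y : Fin N → Y) : ℝ :=
  if StopsAt y0 S y k ∧ ∀ j, j < k → ¬ StopsAt y0 S y j then 1 else 0

lemma sum_stopRuleProb_mul {N : ℕ} {y0 : Y} {S : ℕ → (ℕ → Y) → Prop} {y : Fin N → Y} {τ : Fin N}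
    (h1 : StopsAt y0 S y τ) (h2 : ∀ k, StopsAt y0 S y k → τ ≤ k) (F : Fin N → ℝ) :
    ∑ k, stopRuleProb y0 S k y * F k = F τ := by
  rw [Finset.sum_eq_single τ]
  · rw [stopRuleProb, if_pos ⟨h1, fun j hj hs => (h2 j hs).not_gt hj⟩, one_mul]
  · intro k _ hk
    rw [stopRuleProb, if_neg, zero_mul]
    rintro ⟨h3, h4⟩
    exact h4 τ (lt_of_le_of_ne (h2 k h3) (Ne.symm hk)) h1
  · simp

/-- The code with a given deterministic stopping rule and decision function. -/
def AsyncCode.ofStopRule {n A M : ℕ} (hM : 2 ≤ M) (hA : 1 ≤ A) (hn : 0 < A + n - 1)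
    (cw : Fin M → Fin n → X) (y0 : Y) (S : ℕ → (ℕ → Y) → Prop) (D : (ℕ → Y) → Fin M) :
    AsyncCode X Y n where
  M := M
  two_le_M := hM
  A := A
  one_le_A := hA
  codeword := cw
  stopProb := stopRuleProb y0 S
  stopProb_nonneg k y := by
    unfold stopRuleProb
    split_ifs <;> norm_num
  stopProb_sum y := by
    obtain ⟨τ, h1, h2⟩ := exists_stop_index hn y0 S y
    simpa using sum_stopRuleProb_mul h1 h2 fun _ => 1
  stopProb_adapted k y y' h := by
    have h1 := stopsAt_congr (y0 := y0) (S := S) h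
    have h2 : ∀ j, j < k → (StopsAt y0 S y j ↔ StopsAt y0 S y' j) := fun j hj =>
      stopsAt_congr fun i hi => h i (hi.trans hj.le)
    have h3 : (StopsAt y0 S y k ∧ ∀ j, j < k → ¬ StopsAt y0 S y j) ↔
        (StopsAt y0 S y' k ∧ ∀ j, j < k → ¬ StopsAt y0 S y' j) :=
      and_congr h1 (forall₂_congr fun j hj => not_congr (h2 j hj))
    simp only [stopRuleProb]
    split_ifs with h4 h5 h5
    · rfl
    · exact absurd (h3.1 h4) h5
    · exact absurd (h3.2 h5) h4
    · rfl
  decision k y := D (observed y0 y k)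
  decision_adapted k y y' h := by rw [observed_congr h]

end StopRule

/-! ### Locating the start of a code word from two hits; pathwise analysis of the receiver. -/

section Synchronization

variable {Y : Type*}

/-- The first two occurrences of `hit` in `u` are at two distinct marks of a preamble that
starts at `s`; the marks are the powers of two. -/
def SyncAt (hit : Y → Prop) (u : ℕ → Y) (s : ℕ) : Prop :=
  ∃ i j, i < j ∧ hit (u (s + 2 ^ i)) ∧ hit (u (s + 2 ^ j)) ∧
    ∀ l, l < s + 2 ^ j → hit (u l) → l = s + 2 ^ i

/-- A positive difference of two powers of two determines both. If `j < j'`, then `2 ^ j` and `2 ^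
i'` are each at most half of `2 ^ j'`, so the left side is too small. -/
lemma two_pow_sub_unique {i j i' j' : ℕ} (hij : i < j) (hij' : i' < j')
    (h : 2 ^ j + 2 ^ i' = 2 ^ j' + 2 ^ i) : i = i' := by
  have key : ∀ {i j i' j' : ℕ}, i' < j' → 2 ^ j + 2 ^ i' = 2 ^ j' + 2 ^ i → ¬ j < j' := by
    intro i j i' j' hij' h hj
    have h1 : 2 ^ (j + 1) ≤ 2 ^ j' := Nat.pow_le_pow_right (by norm_num) hj
    have h2 : 2 ^ (i' + 1) ≤ 2 ^ j' := Nat.pow_le_pow_right (by norm_num) hij'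
    have h3 : 0 < 2 ^ i := by positivity
    rw [pow_succ] at h1 h2
    omega
  have hj : j = j' := le_antisymm (not_lt.1 (key hij h.symm)) (not_lt.1 (key hij' h))
  subst hj
  exact Nat.pow_right_injective le_rfl (by omega : 2 ^ i = 2 ^ i')

/-- The times of the first two hits depend on `u` only; their difference identifies the marks, hence
the start. -/
lemma SyncAt.unique {hit : Y → Prop} {u : ℕ → Y} {s s' : ℕ} (h : SyncAt hit u s)
    (h' : SyncAt hit u s') : s = s' := by
  obtain ⟨i, j, hij, hi, hj, hl⟩ := h
  obtain ⟨i', j', hij', hi', hj', hl'⟩ := h'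
  have p1 : 2 ^ i < 2 ^ j := Nat.pow_lt_pow_right (by norm_num) hij
  have p2 : 2 ^ i' < 2 ^ j' := Nat.pow_lt_pow_right (by norm_num) hij'
  have e1 : s + 2 ^ i = s' + 2 ^ i' := by
    by_cases h1 : s' + 2 ^ i' < s + 2 ^ j
    · exact (hl _ h1 hi').symm
    · exact hl' _ (by omega) hi
  have e2 : s + 2 ^ j = s' + 2 ^ j' := by
    rcases lt_trichotomy (s + 2 ^ j) (s' + 2 ^ j') with h1 | h1 | h1
    · have := hl' _ h1 hj
      omega
    · exact h1
    · have := hl _ h1 hj'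
      omega
  have : i = i' := two_pow_sub_unique hij hij' (by omega)
  subst this
  omega

open Classical in
/-- Decode the block that follows a preamble of length `a`, once synchronized. -/
def syncDecode {M kk : ℕ} (hit : Y → Prop) (a : ℕ) (dec : (Fin kk → Y) → Fin M) (m0 : Fin M)
    (u : ℕ → Y) : Fin M :=
  if h : ∃ s, SyncAt hit u s then dec fun j => u (h.choose + a + j) else m0

/-- Stop `L` instants after the first hit, or, in the absence of any hit, as soon as the last
`B` outputs pass `test`. -/
def syncStop {B : ℕ} (hit : Y → Prop) (L : ℕ) (test : (Fin B → Y) → Prop) (k : ℕ)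
    (u : ℕ → Y) : Prop :=
  (∃ i, i + L ≤ k ∧ hit (u i)) ∨
    ((∀ i, ¬ hit (u i)) ∧ ∃ s, s + (L + B) = k + 1 ∧ test fun j => u (s + L + j))

variable {hit : Y → Prop} {a kk B A t τ J : ℕ} {test : (Fin B → Y) → Prop} {v : ℕ → Y}
  {obs : ℕ → ℕ → Y}

/-- If the preamble is received well and there was no false alarm, the block is decoded. -/
lemma syncDecode_eq {M : ℕ} (dec : (Fin kk → Y) → Fin M) (m0 : Fin M)
    (ht : t < A) (ha : a = 2 ^ (2 * J)) (hB : a < B)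
    (hobs : ∀ k i, i ≤ k → obs k i = v i) (hobs' : ∀ k i, k < i → ¬ hit (obs k i))
    (hnoise : ∀ i, i < t → ¬ hit (v i))
    (hpre : ∀ l, l < a → hit (v (t + l)) → ∃ i, l = 2 ^ i)
    (hfst : ∃ i, i < J ∧ hit (v (t + 2 ^ i)))
    (hsnd : ∃ i, J ≤ i ∧ i < 2 * J ∧ hit (v (t + 2 ^ i)))
    (hfalse : ∀ s, s + (a + kk + B) ≤ t + a →
      (∀ j : Fin B, ¬ hit (v (s + (a + kk) + j))) → ¬ test fun j => v (s + (a + kk) + j))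
    (hτ : syncStop hit (a + kk) test τ (obs τ) ∨ τ + 1 = A + (a + kk + B) - 1)
    (hτ' : ∀ k, k < A + (a + kk + B) - 1 → syncStop hit (a + kk) test k (obs k) → τ ≤ k) :
    syncDecode hit a dec m0 (obs τ) = dec fun j => v (t + a + j) := by
  classical
  have hex : ∃ i, hit (v (t + 2 ^ i)) := hfst.imp fun i h => h.2
  obtain ⟨i0, hi0, hmin⟩ : ∃ i0, hit (v (t + 2 ^ i0)) ∧ ∀ i, i < i0 → ¬ hit (v (t + 2 ^ i)) :=
    ⟨Nat.find hex, Nat.find_spec hex, fun i hi => Nat.find_min hex hi⟩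
  have hi0J : i0 < J := by
    obtain ⟨i, hiJ, hi⟩ := hfst
    by_contra hc
    exact hmin i (by omega) hi
  have hex2 : ∃ i, i0 < i ∧ hit (v (t + 2 ^ i)) := by
    obtain ⟨i, hiJ, -, hi⟩ := hsnd
    exact ⟨i, by omega, hi⟩
  obtain ⟨j0, ⟨hij0, hj0⟩, hmin2⟩ : ∃ j0, (i0 < j0 ∧ hit (v (t + 2 ^ j0))) ∧
      ∀ i, i < j0 → ¬ (i0 < i ∧ hit (v (t + 2 ^ i))) :=
    ⟨Nat.find hex2, Nat.find_spec hex2, fun i hi => Nat.find_min hex2 hi⟩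
  have hj0J : j0 < 2 * J := by
    obtain ⟨i, hiJ, hi2, hi⟩ := hsnd
    by_contra hc
    exact hmin2 i (by omega) ⟨by omega, hi⟩
  have pw : ∀ {p q : ℕ}, p < q → 2 ^ p < 2 ^ q := fun h => Nat.pow_lt_pow_right (by norm_num) h
  have hj0a : 2 ^ j0 < a := ha ▸ pw hj0J
  have hi0j0 : 2 ^ i0 < 2 ^ j0 := pw hij0
  have hi0pos : 0 < 2 ^ i0 := Nat.two_pow_pos i0
  have hfirst : ∀ i, i < t + 2 ^ i0 → ¬ hit (v i) := by
    intro i hi hh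
    by_cases hit' : i < t
    · exact hnoise i hit' hh
    · obtain ⟨p, hp⟩ := hpre (i - t) (by omega) (by rwa [Nat.add_sub_cancel' (by omega)])
      have hpi : p < i0 := by
        by_contra hc
        have : 2 ^ i0 ≤ 2 ^ p := Nat.pow_le_pow_right (by norm_num) (by omega)
        omega
      exact hmin p hpi (by rwa [← hp, Nat.add_sub_cancel' (by omega)])
  -- This bound and the next show that `τ` is exactly `a + kk` after the first hit. By then the
  -- preamble and the block have been received in full.
  have hle : τ ≤ t + 2 ^ i0 + (a + kk) := by
    refine hτ' _ (by omega) (Or.inl ⟨t + 2 ^ i0, le_rfl, ?_⟩)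
    rwa [hobs _ _ (by omega)]
  have hobs_hit : ∀ i, hit (obs τ i) → i ≤ τ ∧ hit (v i) := by
    intro i hi
    have h1 : i ≤ τ := by
      by_contra hc
      exact hobs' τ i (by omega) hi
    exact ⟨h1, by rwa [hobs _ _ h1] at hi⟩
  have hge : t + 2 ^ i0 + (a + kk) ≤ τ := by
    rcases hτ with (⟨i, hiL, hi⟩ | ⟨hno, s, hs, htest⟩) | hlast
    · have h1 := (hobs_hit i hi).2
      have h2 : ¬ i < t + 2 ^ i0 := fun hc => hfirst i hc h1
      omega
    -- Stopping by the test requires that no hit has been seen, so the tested window ends before `t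
    -- + a`: a false alarm, which is excluded.
    · exfalso
      have h1 : τ < t + 2 ^ i0 := by
        by_contra hc
        refine hno (t + 2 ^ i0) ?_
        rwa [hobs _ _ (by omega)]
      have h2 : ∀ j : Fin B, obs τ (s + (a + kk) + j) = v (s + (a + kk) + j) := fun j =>
        hobs _ _ (by omega)
      refine hfalse s (by omega) (fun j => ?_) ?_
      · rw [← h2 j]
        exact hno _
      · simpa only [h2] using htest
    -- The forced stop at the last instant is no earlier, since `2 ^ i0 < a < B`.
    · omega
  have hsync : SyncAt hit (obs τ) t := by
    refine ⟨i0, j0, hij0, ?_, ?_, ?_⟩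
    · rwa [hobs _ _ (by omega)]
    · rwa [hobs _ _ (by omega)]
    · intro l hl hh
      have h1 := (hobs_hit l hh).2
      have h2 : ¬ l < t + 2 ^ i0 := fun hc => hfirst l hc h1
      obtain ⟨p, hp⟩ := hpre (l - t) (by omega) (by rwa [Nat.add_sub_cancel' (by omega)])
      have hpj : p < j0 := by
        by_contra hc
        have : 2 ^ j0 ≤ 2 ^ p := Nat.pow_le_pow_right (by norm_num) (by omega)
        omega
      have hip : ¬ i0 < p := fun hc => hmin2 p hpj
        ⟨hc, by rwa [← hp, Nat.add_sub_cancel' (by omega)]⟩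
      have : 2 ^ p ≤ 2 ^ i0 := Nat.pow_le_pow_right (by norm_num) (by omega)
      omega
  have hexs : ∃ s, SyncAt hit (obs τ) s := ⟨t, hsync⟩
  rw [syncDecode, dif_pos hexs]
  have hs : hexs.choose = t := hexs.choose_spec.unique hsync
  rw [hs]
  congr 1
  funext j
  exact hobs _ _ (by omega)

/-- Deterministic bound on the reaction delay. -/
lemma syncStop_delay_le (ht : t < A) (ha : a = 2 ^ (2 * J)) (hB : a < B)
    (hobs : ∀ k i, i ≤ k → obs k i = v i) (hobs' : ∀ k i, k < i → ¬ hit (obs k i))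
    (hτN : τ < A + (a + kk + B) - 1)
    (hτ' : ∀ k, k < A + (a + kk + B) - 1 → syncStop hit (a + kk) test k (obs k) → τ ≤ k) :
    max 0 ((τ : ℝ) - t) ≤ (2 * a + kk : ℝ) +
      2 * ((a + kk + B : ℕ) : ℝ) * ind (∀ i : Fin J, ¬ hit (v (t + 2 ^ i.1))) +
      ((A + (a + kk + B) : ℕ) : ℝ) * ind (¬ test fun j => v (t + (a + kk) + j)) := by
  classical
  have hafter : ∀ i, hit (v i) → τ ≤ i + (a + kk) := by
    intro i hi
    by_cases h : i + (a + kk) < A + (a + kk + B) - 1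
    · refine hτ' _ h (Or.inl ⟨i, le_rfl, ?_⟩)
      rwa [hobs _ _ (by omega)]
    · omega
  have hapos : 0 < a := ha ▸ Nat.two_pow_pos _
  -- A hit among the first `J` marks stops the receiver within `2 * a + kk`. Failing that, a passed
  -- test on the true tail stops it by the end of the code word, unless some other hit delays the
  -- stop by at most `a + kk`. Failing both, `τ` is bounded by the horizon.
  have key : τ ≤ t + (2 * a + kk) +
      2 * (a + kk + B) * (if ∀ i : Fin J, ¬ hit (v (t + 2 ^ i.1)) then 1 else 0) +
      (A + (a + kk + B)) * (if ¬ test (fun j => v (t + (a + kk) + j)) then 1 else 0) := by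
    by_cases h1 : ∀ i : Fin J, ¬ hit (v (t + 2 ^ i.1))
    · rw [if_pos h1]
      by_cases h2 : ¬ test (fun j => v (t + (a + kk) + j))
      · rw [if_pos h2]
        omega
      · rw [if_neg h2]
        rw [not_not] at h2
        by_cases h3 : ∃ i, i ≤ t + (a + kk + B) - 1 ∧ hit (v i)
        · obtain ⟨i, hi, hi'⟩ := h3
          have := hafter i hi'
          omega
        · push Not at h3
          have : τ ≤ t + (a + kk + B) - 1 := by
            refine hτ' _ (by omega) (Or.inr ⟨fun i hi => ?_, t, by omega, ?_⟩)
            · by_cases hik : i ≤ t + (a + kk + B) - 1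
              · rw [hobs _ _ hik] at hi
                exact h3 i hik hi
              · exact hobs' _ _ (by omega) hi
            · have h4 : ∀ j : Fin B, obs (t + (a + kk + B) - 1) (t + (a + kk) + j) =
                  v (t + (a + kk) + j) := fun j => hobs _ _ (by omega)
              simpa only [h4] using h2
          omega
    · rw [if_neg h1]
      push Not at h1
      obtain ⟨i, hi⟩ := h1
      have h3 := hafter _ hi
      have h4 : 2 ^ i.1 < a := ha ▸ Nat.pow_lt_pow_right (by norm_num) (by omega)
      generalize 2 ^ i.1 = q at *
      omega
  have key' : (τ : ℝ) ≤ t + (2 * a + kk) +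
      2 * ((a + kk + B : ℕ) : ℝ) * ind (∀ i : Fin J, ¬ hit (v (t + 2 ^ i.1))) +
      ((A + (a + kk + B) : ℕ) : ℝ) * ind (¬ test fun j => v (t + (a + kk) + j)) := by
    have hc : ∀ (p : Prop) [Decidable p], ind p = ((if p then 1 else 0 : ℕ) : ℝ) := by
      intro p _
      by_cases hp : p
      · rw [ind_pos hp, if_pos hp, Nat.cast_one]
      · rw [ind_neg hp, if_neg hp, Nat.cast_zero]
    rw [hc, hc]
    exact_mod_cast key
  have i1 := ind_nonneg (∀ i : Fin J, ¬ hit (v (t + 2 ^ i.1)))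
  have i2 := ind_nonneg (¬ test fun j => v (t + (a + kk) + j))
  exact max_le (by positivity) (by linarith)

end Synchronization

section ProductExpectation

variable {I Y : Type*} [Fintype I] [DecidableEq I] [Fintype Y]

lemma prodE_prod (μ : I → ProbDist Y) (f : Y → ℝ) :
    prodE μ (fun y => ∏ i, f (y i)) = ∏ i, ∑ b, (μ i).1 b * f b := by
  have h := Finset.prod_univ_sum (fun _ : I => (Finset.univ : Finset Y))
    (fun i y => (μ i).1 y * f y)
  rw [Fintype.piFinset_univ] at h
  rw [h, prodE]
  exact Finset.sum_congr rfl fun y _ => Finset.prod_mul_distrib.symm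

lemma prodE_forall_not (μ : I → ProbDist Y) (hit : Y → Prop) :
    prodE μ (fun y => ind (∀ i, ¬ hit (y i))) = ∏ i, ∑ b, (μ i).1 b * ind (¬ hit b) := by
  rw [← prodE_prod μ fun b => ind (¬ hit b)]
  congr 1
  funext y
  by_cases hy : ∀ i, ¬ hit (y i)
  · rw [ind_pos hy]
    exact (Finset.prod_eq_one fun i _ => ind_pos (hy i)).symm
  · rw [ind_neg hy]
    push Not at hy
    obtain ⟨i, hi⟩ := hy
    exact (Finset.prod_eq_zero (Finset.mem_univ i) (ind_neg (not_not.2 hi))).symm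

end ProductExpectation

/-! ### Blocks of consecutive instants. -/

section Window

variable {Y : Type*} {N : ℕ}

/-- The block of `B` consecutive coordinates from `s` on. -/
def window {B : ℕ} (s : ℕ) (h : s + B ≤ N) (j : Fin B) : Fin N := ⟨s + j, by omega⟩

lemma window_injective {B : ℕ} (s : ℕ) (h : s + B ≤ N) :
    Function.Injective (window s h) := by
  intro j j' hj
  have := congrArg Fin.val hj
  simp only [window] at this
  exact Fin.ext (by omega)

lemma observed_of_lt {y0 : Y} {y : Fin N → Y} {k i : ℕ} (h : i < N) (hk : i ≤ k) :
    observed y0 y k i = y ⟨i, h⟩ := dif_pos ⟨h, hk⟩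

end Window

/-! ### The synchronizing code: its laws, delay and error probability. -/

section Scheme

variable {X Y : Type*} [Fintype X] [Fintype Y]

open Classical in
/-- The letters sent: a preamble of length `a` with the letter `x` at the powers of two, a block
code word, and a fixed tail. -/
def sentLetter {kk B : ℕ} (star x : X) (a : ℕ) (cw : Fin kk → X) (w : Fin B → X) (l : ℕ) : X :=
  if l < a then if ∃ i, l = 2 ^ i then x else star
  else if h : l - a < kk then cw ⟨l - a, h⟩
  else if h : l - a - kk < B then w ⟨l - a - kk, h⟩
  else star

lemma input_eq {n : ℕ} (c : AsyncCode X Y n) (star : X) (m : Fin c.M) (t : Fin c.A)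
    (i : Fin (c.A + n - 1)) (f : ℕ → X) (hf : ∀ l : Fin n, c.codeword m l = f l)
    (hf' : ∀ l, n ≤ l → f l = star) :
    c.input star m t i = if t.1 ≤ i.1 then f (i.1 - t.1) else star := by
  unfold AsyncCode.input
  by_cases h1 : t.1 ≤ i.1
  · by_cases h2 : i.1 < t.1 + n
    · rw [dif_pos ⟨h1, h2⟩, if_pos h1, hf]
    · rw [dif_neg fun h => h2 h.2, if_pos h1, hf' _ (by omega)]
  · rw [dif_neg fun h => h1 h.1, if_neg h1]

variable (Q : Channel X Y) (star x : X)

/-- Letters that the noise cannot produce. -/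
def Surprising (y : Y) : Prop := (Q star).1 y = 0

/-- The probability that `x` does not produce a letter that the noise cannot produce. -/
def missProb : ℝ := ∑ y, (Q x).1 y * ind (¬ Surprising Q star y)

lemma missProb_nonneg : 0 ≤ missProb Q star x :=
  Finset.sum_nonneg fun y _ => mul_nonneg ((Q x).2.1 y) (ind_nonneg _)

/-- The likelihood ratio test for the word `w`. -/
def LikelihoodTest {B : ℕ} (w : Fin B → X) (z : Fin B → Y) : Prop :=
  memoryless (fun _ => Q star) w z < memoryless Q w z

/-- Total error of the likelihood ratio test for the word `w`. -/
def testError {B : ℕ} (w : Fin B → X) : ℝ :=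
  ∑ z, min (memoryless Q w z) (memoryless (fun _ => Q star) w z)

lemma testError_nonneg {B : ℕ} (w : Fin B → X) : 0 ≤ testError Q star w :=
  Finset.sum_nonneg fun _ _ => le_min (memoryless_nonneg _ _ _) (memoryless_nonneg _ _ _)

/-- Where the test fails, the minimum in `testError` is the probability under `Q`. -/
lemma missed_le_testError {B : ℕ} (w : Fin B → X) :
    prodE (fun j => Q (w j)) (fun z => ind (¬ LikelihoodTest Q star w z)) ≤
      testError Q star w := by
  refine Finset.sum_le_sum fun z _ => ?_
  beta_reduce
  by_cases h : ¬ LikelihoodTest Q star w z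
  · rw [ind_pos h, mul_one]
    exact le_min le_rfl (not_lt.1 h)
  · rw [ind_neg h, mul_zero]
    exact le_min (memoryless_nonneg _ _ _) (memoryless_nonneg _ _ _)

open Classical in
/-- False alarm probability on a window that overlaps few letters of the transmission. -/
lemma falseAlarm_le {B a : ℕ} {K : ℝ} (hK : 1 ≤ K)
    (hKx : ∀ y, ¬ Surprising Q star y → (Q x).1 y ≤ K * (Q star).1 y) (w : Fin B → X)
    (inp : Fin B → X) (hinp : ∀ j, inp j = x ∨ inp j = star)
    (hcard : (Finset.univ.filter fun j => ¬ inp j = star).card ≤ a) :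
    prodE (fun j => Q (inp j)) (fun z => ind ((∀ j, ¬ Surprising Q star (z j)) ∧
      LikelihoodTest Q star w z)) ≤ K ^ a * testError Q star w := by
  unfold testError
  rw [Finset.mul_sum]
  refine Finset.sum_le_sum fun z _ => ?_
  have hKa : 0 ≤ K ^ a := pow_nonneg (by linarith) a
  beta_reduce
  by_cases h : (∀ j, ¬ Surprising Q star (z j)) ∧ LikelihoodTest Q star w z
  · rw [ind_pos h, mul_one, min_eq_right h.2.le]
    -- Without hits, each letter of the preamble costs at most a factor `K` in passing to pure
    -- noise, and at most `a` letters are concerned.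
    have h1 : ∀ j, (Q (inp j)).1 (z j) ≤ (if inp j = star then 1 else K) * (Q star).1 (z j) := by
      intro j
      split_ifs with hj
      · rw [hj, one_mul]
      · rw [(hinp j).resolve_right hj]
        exact hKx _ (h.1 j)
    calc ∏ j, (Q (inp j)).1 (z j)
        ≤ ∏ j, ((if inp j = star then 1 else K) * (Q star).1 (z j)) :=
          Finset.prod_le_prod (fun j _ => (Q (inp j)).2.1 _) fun j _ => h1 j
      _ = K ^ (Finset.univ.filter fun j => ¬ inp j = star).card *
            memoryless (fun _ => Q star) w z := by
          rw [Finset.prod_mul_distrib, Finset.prod_ite]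
          simp [memoryless]
      _ ≤ _ := mul_le_mul_of_nonneg_right (pow_le_pow_right₀ hK hcard) (memoryless_nonneg _ _ _)
  · rw [ind_neg h, mul_zero]
    exact mul_nonneg hKa (le_min (memoryless_nonneg _ _ _) (memoryless_nonneg _ _ _))

/-- The synchronizing scheme. -/
def syncCode {kk B A : ℕ} (a : ℕ) (blk : BlockCode X Y kk) (hM : 2 ≤ blk.M) (hA : 1 ≤ A)
    (hB : a < B) (w : Fin B → X) (y0 : Y) : AsyncCode X Y (a + kk + B) :=
  AsyncCode.ofStopRule hM hA (by omega) (fun m l => sentLetter star x a (blk.codeword m) w l) y0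
    (syncStop (Surprising Q star) (a + kk) (LikelihoodTest Q star w))
    (syncDecode (Surprising Q star) a blk.decode ⟨0, by omega⟩)

/-- The input at the instant of index `i` when the transmission of `cw` starts at `t`. -/
def inputAt {kk B : ℕ} (a : ℕ) (cw : Fin kk → X) (w : Fin B → X) (t i : ℕ) : X :=
  if t ≤ i then sentLetter star x a cw w (i - t) else star

section Analysis

variable {Q star x}
variable {kk B A a J : ℕ} (blk : BlockCode X Y kk) (hM : 2 ≤ blk.M) (hA : 1 ≤ A) (hB : a < B)
  (w : Fin B → X) {y0 : Y}

lemma syncCode_input (m : Fin blk.M) (t : Fin A) (i : Fin (A + (a + kk + B) - 1)) :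
    (syncCode Q star x a blk hM hA hB w y0).input star m t i =
      inputAt star x a (blk.codeword m) w t i := by
  refine input_eq (syncCode Q star x a blk hM hA hB w y0) star m t i _ (fun l => rfl) ?_
  intro l hl
  unfold sentLetter
  rw [if_neg (by omega), dif_neg (by omega), dif_neg (by omega)]

lemma inputAt_block (cw : Fin kk → X) (t : ℕ) (j : Fin kk) :
    inputAt star x a cw w t (t + a + j) = cw j := by
  unfold inputAt sentLetter
  have h : t + a + j.1 - t - a = j := by omega
  rw [if_pos (by omega), if_neg (by omega), dif_pos (by omega)]
  simp only [h]

lemma inputAt_tail (cw : Fin kk → X) (t : ℕ) (j : Fin B) :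
    inputAt star x a cw w t (t + (a + kk) + j) = w j := by
  unfold inputAt sentLetter
  have h : t + (a + kk) + j.1 - t - a - kk = j := by omega
  rw [if_pos (by omega), if_neg (by omega), dif_neg (by omega), dif_pos (by omega)]
  simp only [h]

lemma inputAt_mark (ha : a = 2 ^ (2 * J)) (cw : Fin kk → X) (t : ℕ) {i : ℕ} (hi : i < 2 * J) :
    inputAt star x a cw w t (t + 2 ^ i) = x := by
  unfold inputAt sentLetter
  have h : 2 ^ i < a := ha ▸ Nat.pow_lt_pow_right (by norm_num) hi
  have h' : 0 < 2 ^ i := Nat.two_pow_pos i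
  rw [if_pos (by omega), if_pos (by omega), if_pos ⟨i, by omega⟩]

lemma inputAt_of_lt (cw : Fin kk → X) {t i : ℕ} (hi : i < t) :
    inputAt star x a cw w t i = star := if_neg (by omega)

lemma inputAt_preamble (cw : Fin kk → X) {t i : ℕ} (hi : i < t + a) :
    inputAt star x a cw w t i = x ∨ inputAt star x a cw w t i = star := by
  unfold inputAt sentLetter
  split_ifs <;> simp_all <;> omega

lemma inputAt_not_mark (cw : Fin kk → X) (t : ℕ) {l : ℕ} (hl : l < a) (h : ¬ ∃ i : ℕ, l = 2 ^ i) :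
    inputAt star x a cw w t (t + l) = star := by
  unfold inputAt sentLetter
  rw [if_pos (by omega), if_pos (by omega), if_neg (by rwa [Nat.add_sub_cancel_left])]

/-- The law of the outputs. -/
def outputLaw (Q : Channel X Y) (star x : X) (a : ℕ) (cw : Fin kk → X) (w : Fin B → X)
    (N t : ℕ) (i : Fin N) : ProbDist Y := Q (inputAt star x a cw w t i)

lemma syncCode_outputProb (m : Fin blk.M) (t : Fin A) (y : Fin (A + (a + kk + B) - 1) → Y) :
    (syncCode Q star x a blk hM hA hB w y0).outputProb Q star m t y =
      ∏ i, (outputLaw Q star x a (blk.codeword m) w (A + (a + kk + B) - 1) t i).1 (y i) := by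
  unfold AsyncCode.outputProb memoryless
  refine Finset.prod_congr rfl fun i _ => ?_
  exact congrArg (fun b => (Q b).1 (y i)) (syncCode_input blk hM hA hB w m t i)

lemma prodE_noMark {N t lo : ℕ} (ha : a = 2 ^ (2 * J)) (cw : Fin kk → X)
    (hN : t + a ≤ N) (hlo : lo + J ≤ 2 * J) :
    prodE (outputLaw Q star x a cw w N t) (fun y => ind (∀ i : Fin J,
      ¬ Surprising Q star (observed y0 y N (t + 2 ^ (lo + i.1))))) =
      missProb Q star x ^ J := by
  have hlt : ∀ i : Fin J, t + 2 ^ (lo + i.1) < N := fun i => by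
    have : 2 ^ (lo + i.1) < a := ha ▸ Nat.pow_lt_pow_right (by norm_num) (by omega)
    omega
  have hinj : Function.Injective fun i : Fin J => (⟨t + 2 ^ (lo + i.1), hlt i⟩ : Fin N) := by
    intro i i' h
    have h1 : t + 2 ^ (lo + i.1) = t + 2 ^ (lo + i'.1) := congrArg Fin.val h
    have h2 : lo + i.1 = lo + i'.1 := Nat.pow_right_injective le_rfl (Nat.add_left_cancel h1)
    exact Fin.ext (by omega)
  have h1 := prodE_comp (outputLaw Q star x a cw w N t) hinj
    (fun z => ind (∀ i, ¬ Surprising Q star (z i)))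
  have h2 : ∀ (y : Fin N → Y) (i : Fin J), observed y0 y N (t + 2 ^ (lo + i.1)) =
      y ⟨t + 2 ^ (lo + i.1), hlt i⟩ := fun y i => observed_of_lt (hlt i) (hlt i).le
  simp only [h2]
  rw [h1, prodE_forall_not]
  have h3 : ∀ i : Fin J, outputLaw Q star x a cw w N t ⟨t + 2 ^ (lo + i.1), hlt i⟩ = Q x := by
    intro i
    rw [outputLaw, inputAt_mark w ha cw t (by omega)]
  simp only [h3]
  rw [Finset.prod_const, Finset.card_univ, Fintype.card_fin]
  rfl

lemma prodE_window {N s n : ℕ} (μ : Fin N → ProbDist Y) (h : s + n ≤ N) (F : (Fin n → Y) → ℝ) :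
    prodE μ (fun y => F fun j => observed y0 y N (s + j)) =
      prodE (fun j => μ (window s h j)) F := by
  rw [← prodE_comp μ (window_injective s h)]
  congr 1
  funext y
  congr 1
  funext j
  exact observed_of_lt (by omega) (by omega)

lemma blockError_le (m : Fin blk.M) :
    prodE (fun j => Q (blk.codeword m j)) (fun z => ind (blk.decode z ≠ m)) ≤
      blk.maxError Q := by
  refine le_trans (le_of_eq ?_) (le_ciSup (Set.finite_range _).bddAbove m)
  refine Finset.sum_congr rfl fun z _ => ?_
  beta_reduce
  rw [mul_ind]
  rfl

lemma syncCode_stop (t : Fin A) (y : Fin (A + (a + kk + B) - 1) → Y) :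
    ∃ τ : Fin (A + (a + kk + B) - 1),
      StopsAt y0 (syncStop (Surprising Q star) (a + kk) (LikelihoodTest Q star w)) y τ ∧
      (∀ k, k < A + (a + kk + B) - 1 → syncStop (Surprising Q star) (a + kk)
        (LikelihoodTest Q star w) k (observed y0 y k) → τ ≤ k) ∧
      ∀ F : Fin (A + (a + kk + B) - 1) → ℝ,
        ∑ k, (syncCode Q star x a blk hM hA hB w y0).stopProb k y * F k = F τ := by
  have := t.2
  obtain ⟨τ, h1, h2⟩ := exists_stop_index (by omega) y0
    (syncStop (Surprising Q star) (a + kk) (LikelihoodTest Q star w)) y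
  exact ⟨τ, h1, fun k hk hs => h2 ⟨k, hk⟩ (Or.inl hs), sum_stopRuleProb_mul h1 h2⟩

lemma observed_eq_full {N : ℕ} (y : Fin N → Y) {k i : ℕ} (h : i ≤ k) :
    observed y0 y k i = observed y0 y N i := by
  unfold observed
  by_cases hi : i < N
  · rw [dif_pos ⟨hi, h⟩, dif_pos ⟨hi, hi.le⟩]
  · rw [dif_neg fun h => hi h.1, dif_neg fun h => hi h.1]

lemma observed_of_gt {N : ℕ} (y : Fin N → Y) {k i : ℕ} (h : k < i) :
    observed y0 y k i = y0 := dif_neg fun h' => by omega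

/-- Expectation of the pathwise bound `syncStop_delay_le`. The letter `y0` pads unseen outputs, so
it must not count as a hit. -/
theorem syncCode_expectedDelay_le (hy0 : ¬ Surprising Q star y0) (ha : a = 2 ^ (2 * J))
    (m : Fin blk.M) (t : Fin A) :
    (syncCode Q star x a blk hM hA hB w y0).expectedDelay Q star m t ≤
      (2 * a + kk : ℝ) + 2 * ((a + kk + B : ℕ) : ℝ) * missProb Q star x ^ J +
      ((A + (a + kk + B) : ℕ) : ℝ) * testError Q star w := by
  classical
  have ht := t.2
  set N := A + (a + kk + B) - 1 with hN
  have hlaw : (syncCode Q star x a blk hM hA hB w y0).expectedDelay Q star m t =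
      prodE (outputLaw Q star x a (blk.codeword m) w N t) fun y =>
        ∑ k, (syncCode Q star x a blk hM hA hB w y0).stopProb k y *
          max 0 ((k.1 : ℝ) - (t.1 : ℝ)) := by
    refine Finset.sum_congr rfl fun y _ => ?_
    congr 1
    exact syncCode_outputProb blk hM hA hB w m t y
  rw [hlaw]
  refine (prodE_mono _ (g := fun y => (2 * a + kk : ℝ) +
      2 * ((a + kk + B : ℕ) : ℝ) * ind (∀ i : Fin J,
        ¬ Surprising Q star (observed y0 y N (t + 2 ^ (0 + i.1)))) +
      ((A + (a + kk + B) : ℕ) : ℝ) * ind (¬ LikelihoodTest Q star w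
        fun j => observed y0 y N (t + (a + kk) + j))) fun y => ?_).trans ?_
  · obtain ⟨τ, -, h2, h3⟩ := syncCode_stop (x := x) (y0 := y0) (Q := Q) (star := star)
      blk hM hA hB w t y
    rw [h3 fun k => max 0 ((k.1 : ℝ) - (t.1 : ℝ))]
    simp only [zero_add]
    refine syncStop_delay_le (hit := Surprising Q star) (obs := fun k i => observed y0 y k i)
      ht ha hB (fun k i hik => observed_eq_full y hik) (fun k i hki => ?_) τ.2 h2
    rwa [observed_of_gt y hki]
  · rw [prodE_add, prodE_add, prodE_const, prodE_const_mul, prodE_const_mul,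
      prodE_noMark (lo := 0) w ha _ (by omega) (by omega)]
    refine add_le_add le_rfl (mul_le_mul_of_nonneg_left ?_ (Nat.cast_nonneg _))
    rw [prodE_window _ (by omega) (fun z : Fin B → Y => ind (¬ LikelihoodTest Q star w z))]
    have : (fun j => outputLaw Q star x a (blk.codeword m) w N t
        (window (N := N) (t + (a + kk)) (by omega) j)) = fun j : Fin B => Q (w j) := by
      funext j
      exact congrArg Q (inputAt_tail w _ _ j)
    rw [this]
    exact missed_le_testError Q star w

/-- Union bound over the ways in which `syncDecode_eq` can fail: no hit in one of the two halves of
the marks, an error of the block decoder, a false alarm of the test. -/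
theorem syncCode_errorProb_le (hy0 : ¬ Surprising Q star y0) (ha : a = 2 ^ (2 * J)) {K : ℝ}
    (hK : 1 ≤ K) (hKx : ∀ y, ¬ Surprising Q star y → (Q x).1 y ≤ K * (Q star).1 y)
    (m : Fin blk.M) (t : Fin A) :
    (syncCode Q star x a blk hM hA hB w y0).errorProb Q star m t ≤
      2 * missProb Q star x ^ J + blk.maxError Q +
      ((A + (a + kk + B) : ℕ) : ℝ) * (K ^ a * testError Q star w) := by
  have ht := t.2
  set N := A + (a + kk + B) - 1 with hN
  -- The relevant false alarms have windows ending before `t + a`; such windows meet only noise and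
  -- preamble, as `falseAlarm_le` needs.
  set S := (Finset.range (A + (a + kk + B))).filter (fun s => s + (a + kk + B) ≤ t.1 + a) with hS
  have hlaw : (syncCode Q star x a blk hM hA hB w y0).errorProb Q star m t =
      prodE (outputLaw Q star x a (blk.codeword m) w N t) fun y =>
        ∑ k, (syncCode Q star x a blk hM hA hB w y0).stopProb k y *
          ind ((syncCode Q star x a blk hM hA hB w y0).decision k y ≠ m) := by
    refine Finset.sum_congr rfl fun y _ => ?_
    exact congrArg₂ (· * ·) (syncCode_outputProb blk hM hA hB w m t y)
      (Finset.sum_congr rfl fun k _ => (mul_ind _ _).symm)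
  rw [hlaw]
  refine (prodE_mono_of_support _ (g := fun y =>
      ind (∀ i : Fin J,
        ¬ Surprising Q star (observed y0 y N (t + 2 ^ (0 + i.1)))) +
      ind (∀ i : Fin J,
        ¬ Surprising Q star (observed y0 y N (t + 2 ^ (J + i.1)))) +
      ind (blk.decode (fun j => observed y0 y N (t + a + j)) ≠ m) +
      ∑ s ∈ S, ind ((∀ j : Fin B,
        ¬ Surprising Q star (observed y0 y N (s + (a + kk) + j))) ∧
        LikelihoodTest Q star w fun j => observed y0 y N (s + (a + kk) + j)))
      fun y hsupp => ?_).trans ?_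
  · obtain ⟨τ, h1, h2, h3⟩ := syncCode_stop (x := x) (y0 := y0) (Q := Q) (star := star)
      blk hM hA hB w t y
    rw [h3 fun k => ind ((syncCode Q star x a blk hM hA hB w y0).decision k y ≠ m)]
    have i3 : ind ((syncCode Q star x a blk hM hA hB w y0).decision τ y ≠ m) ≤ 1 := ind_le_one _
    have i2 : (0 : ℝ) ≤ ∑ s ∈ S, ind ((∀ j : Fin B,
        ¬ Surprising Q star (observed y0 y N (s + (a + kk) + j))) ∧
        LikelihoodTest Q star w fun j => observed y0 y N (s + (a + kk) + j)) :=
      Finset.sum_nonneg fun s _ => ind_nonneg _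
    by_cases e1 : ∀ i : Fin J, ¬ Surprising Q star (observed y0 y N (t + 2 ^ (0 + i.1)))
    · rw [ind_pos e1]
      have := ind_nonneg (∀ i : Fin J, ¬ Surprising Q star (observed y0 y N (t + 2 ^ (J + i.1))))
      have := ind_nonneg (blk.decode (fun j => observed y0 y N (t + a + j)) ≠ m)
      linarith
    by_cases e2 : ∀ i : Fin J, ¬ Surprising Q star (observed y0 y N (t + 2 ^ (J + i.1)))
    · rw [ind_pos e2]
      have := ind_nonneg (∀ i : Fin J, ¬ Surprising Q star (observed y0 y N (t + 2 ^ (0 + i.1))))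
      have := ind_nonneg (blk.decode (fun j => observed y0 y N (t + a + j)) ≠ m)
      linarith
    by_cases e3 : ∃ s ∈ S, (∀ j : Fin B,
        ¬ Surprising Q star (observed y0 y N (s + (a + kk) + j))) ∧
        LikelihoodTest Q star w (fun j => observed y0 y N (s + (a + kk) + j))
    · obtain ⟨s, hs, hs'⟩ := e3
      have h5 := Finset.single_le_sum (f := fun s => ind ((∀ j : Fin B,
        ¬ Surprising Q star (observed y0 y N (s + (a + kk) + j))) ∧
        LikelihoodTest Q star w fun j => observed y0 y N (s + (a + kk) + j)))
        (fun s _ => ind_nonneg _) hs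
      simp only [ind_pos hs'] at h5
      have := ind_nonneg (blk.decode (fun j => observed y0 y N (t + a + j)) ≠ m)
      rw [ind_neg e1, ind_neg e2]
      linarith
    have hdec : (syncCode Q star x a blk hM hA hB w y0).decision τ y =
        blk.decode fun j => observed y0 y N (t + a + j) := by
      push Not at e1 e2 e3
      have hnon : ∀ i : ℕ, inputAt star x a (blk.codeword m) w t i = star →
          ¬ Surprising Q star (observed y0 y N i) := by
        intro i hi
        by_cases hiN : i < N
        · rw [observed_of_lt hiN hiN.le]
          have := hsupp ⟨i, hiN⟩
          rwa [outputLaw, hi] at this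
        · unfold observed
          rwa [dif_neg fun h => hiN h.1]
      refine syncDecode_eq (hit := Surprising Q star) (J := J) (t := t)
        (obs := fun k i => observed y0 y k i) (v := observed y0 y N)
        (test := LikelihoodTest Q star w) blk.decode _ ht ha hB
        (fun k i hik => observed_eq_full y hik) (fun k i hki => ?_) ?_ ?_ ?_ ?_ ?_ h1 h2
      · rwa [observed_of_gt y hki]
      · exact fun i hi => hnon i (inputAt_of_lt w _ hi)
      · intro l hl hh
        by_contra hc
        exact hnon _ (inputAt_not_mark w _ _ hl hc) hh
      · obtain ⟨i, hi⟩ := e1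
        exact ⟨i, i.2, by rwa [zero_add] at hi⟩
      · obtain ⟨i, hi⟩ := e2
        exact ⟨J + i, by omega, by omega, hi⟩
      · intro s hs hs'
        refine e3 s ?_ hs'
        rw [hS, Finset.mem_filter, Finset.mem_range]
        exact ⟨by omega, hs⟩
    rw [ind_neg e1, ind_neg e2, hdec, zero_add, zero_add]
    exact le_add_of_nonneg_right i2
  · rw [prodE_add, prodE_add, prodE_add, prodE_finset_sum,
      prodE_noMark (lo := 0) w ha _ (by omega) (by omega),
      prodE_noMark (lo := J) w ha _ (by omega) (by omega)]
    have b1 : prodE (outputLaw Q star x a (blk.codeword m) w N t)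
        (fun y => ind (blk.decode (fun j => observed y0 y N (t + a + j)) ≠ m)) ≤
        blk.maxError Q := by
      rw [prodE_window _ (by omega) (fun z : Fin kk → Y => ind (blk.decode z ≠ m))]
      have : (fun j => outputLaw Q star x a (blk.codeword m) w N t
          (window (N := N) (t + a) (by omega) j)) = fun j : Fin kk => Q (blk.codeword m j) := by
        funext j
        exact congrArg Q (inputAt_block w _ _ j)
      rw [this]
      exact blockError_le blk m
    have b2 : ∀ s ∈ S, prodE (outputLaw Q star x a (blk.codeword m) w N t)
        (fun y => ind ((∀ j : Fin B,
        ¬ Surprising Q star (observed y0 y N (s + (a + kk) + j))) ∧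
        LikelihoodTest Q star w fun j => observed y0 y N (s + (a + kk) + j))) ≤
        K ^ a * testError Q star w := by
      intro s hs
      have hs2 : s + (a + kk + B) ≤ t.1 + a := (Finset.mem_filter.1 hs).2
      rw [prodE_window _ (by omega) (fun z : Fin B → Y =>
        ind ((∀ j, ¬ Surprising Q star (z j)) ∧ LikelihoodTest Q star w z))]
      classical
      refine falseAlarm_le Q star x hK hKx w
        (fun j => inputAt star x a (blk.codeword m) w t (s + (a + kk) + j))
        (fun j => inputAt_preamble w _ (by omega)) ?_
      have : ∀ j ∈ Finset.univ.filter (fun j : Fin B =>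
          ¬ inputAt star x a (blk.codeword m) w t (s + (a + kk) + j) = star),
          s + (a + kk) + j.1 ∈ Finset.Ico t.1 (t.1 + a) := by
        intro j hj
        rw [Finset.mem_Ico]
        refine ⟨?_, by omega⟩
        by_contra hc
        exact (Finset.mem_filter.1 hj).2 (inputAt_of_lt w _ (by omega))
      have h5 := Finset.card_le_card_of_injOn _ this
        (fun j _ j' _ h => Fin.ext (Nat.add_left_cancel h))
      simpa using h5
    have b3 := Finset.sum_le_sum b2
    rw [Finset.sum_const, nsmul_eq_mul] at b3
    have b4 : (S.card : ℝ) ≤ ((A + (a + kk + B) : ℕ) : ℝ) := by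
      have := Finset.card_filter_le (Finset.range (A + (a + kk + B)))
        (fun s => s + (a + kk + B) ≤ t.1 + a)
      rw [Finset.card_range] at this
      exact_mod_cast this
    have b5 := mul_le_mul_of_nonneg_right b4
      (mul_nonneg (pow_nonneg (by linarith) a) (testError_nonneg Q star w) :
        0 ≤ K ^ a * testError Q star w)
    linarith

end Analysis

end Scheme

/-! ### Choice of the parameters and achievability. -/

section Achievability

open Filter Topology

variable {X Y : Type*} [Fintype X] [Fintype Y]

lemma average_le {A : ℕ} (hA : 1 ≤ A) {f : Fin A → ℝ} {b : ℝ} (h : ∀ t, f t ≤ b) :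
    1 / (A : ℝ) * ∑ t, f t ≤ b := by
  have hA' : (0 : ℝ) < A := by exact_mod_cast hA
  rw [one_div, inv_mul_le_iff₀ hA']
  refine (Finset.sum_le_sum fun t _ => h t).trans ?_
  rw [Finset.sum_const, Finset.card_univ, Fintype.card_fin, nsmul_eq_mul]

lemma AsyncCode.maxError_le {n : ℕ} (c : AsyncCode X Y n) (Q : Channel X Y) (star : X) {b : ℝ}
    (h : ∀ m t, c.errorProb Q star m t ≤ b) : c.maxError Q star ≤ b := by
  have : Nonempty (Fin c.M) := ⟨⟨0, by have := c.two_le_M; omega⟩⟩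
  exact ciSup_le fun m => average_le c.one_le_A (h m)

lemma AsyncCode.delay_le {n : ℕ} (c : AsyncCode X Y n) (Q : Channel X Y) (star : X) {b : ℝ}
    (h : ∀ m t, c.expectedDelay Q star m t ≤ b) : c.delay Q star ≤ b := by
  have : Nonempty (Fin c.M) := ⟨⟨0, by have := c.two_le_M; omega⟩⟩
  exact ciSup_le fun m => average_le c.one_le_A (h m)

/-- The product form also covers a vanishing delay, where the rate is `∞` because `M ≥ 2`. -/
lemma AsyncCode.le_rate_iff {n : ℕ} (c : AsyncCode X Y n) (Q : Channel X Y) (star : X) {r : ℝ}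
    (hr : 0 ≤ r) : ENNReal.ofReal r ≤ c.rate Q star ↔ r * c.delay Q star ≤ Real.log c.M := by
  have hM : 0 < Real.log c.M := Real.log_pos (by
    have := c.two_le_M
    exact_mod_cast this)
  rw [AsyncCode.rate, ENNReal.le_div_iff_mul_le (Or.inr (by simpa using hM))
    (Or.inl ENNReal.ofReal_ne_top), ← ENNReal.ofReal_mul hr, ENNReal.ofReal_le_ofReal_iff hM.le]

lemma AsyncCode.le_rate {n : ℕ} (c : AsyncCode X Y n) (Q : Channel X Y) (star : X) {r b : ℝ}
    (hr : 0 ≤ r) (hb : c.delay Q star ≤ b) (h : r * b ≤ Real.log c.M) :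
    ENNReal.ofReal r ≤ c.rate Q star :=
  (c.le_rate_iff Q star hr).2 ((mul_le_mul_of_nonneg_left hb hr).trans h)

/-- The requirements on the `n`-th code, up to the tolerance `ε`. -/
def AsyncCode.Meets (Q : Channel X Y) (star : X) (R α : ℝ≥0) (ε : ℝ) {n : ℕ}
    (c : AsyncCode X Y n) : Prop :=
  (Real.exp (((α : ℝ) - ε) * n) ≤ c.A ∧ (c.A : ℝ) ≤ Real.exp ((α : ℝ) * n)) ∧
    ENNReal.ofReal ((R : ℝ) - ε) ≤ c.rate Q star ∧ c.maxError Q star ≤ ε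

lemma AsyncCode.Meets.mono {Q : Channel X Y} {star : X} {R α : ℝ≥0} {ε ε' : ℝ} {n : ℕ}
    {c : AsyncCode X Y n} (h : c.Meets Q star R α ε) (hε : ε ≤ ε') : c.Meets Q star R α ε' := by
  obtain ⟨⟨h1, h2⟩, h3, h4⟩ := h
  refine ⟨⟨le_trans (Real.exp_le_exp.2 ?_) h1, h2⟩,
    (ENNReal.ofReal_le_ofReal (by linarith)).trans h3, h4.trans hε⟩
  exact mul_le_mul_of_nonneg_right (by linarith) (Nat.cast_nonneg n)

/-- Diagonalization: it suffices to meet each tolerance by codes that depend on it. -/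
lemma achievable_of_forall_eventually (Q : Channel X Y) (star : X) (R α : ℝ≥0) {ε0 : ℝ}
    (hε0 : 0 < ε0) (h : ∀ ε : ℝ, 0 < ε → ε < ε0 → ∀ᶠ n : ℕ in atTop,
      ∃ c : AsyncCode X Y n, c.Meets Q star R α ε) : Achievable Q star R α := by
  classical
  have h' : ∀ k : ℕ, ∀ᶠ n : ℕ in atTop,
      ∃ c : AsyncCode X Y n, c.Meets Q star R α (1 / ((k : ℝ) + 1)) := by
    intro k
    have hk : 0 < 1 / ((k : ℝ) + 1) := by positivity
    filter_upwards [h (min (1 / ((k : ℝ) + 1)) (ε0 / 2)) (lt_min hk (by linarith))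
      (lt_of_le_of_lt (min_le_right _ _) (by linarith))] with n hn
    obtain ⟨c, hc⟩ := hn
    exact ⟨c, hc.mono (min_le_left _ _)⟩
  obtain ⟨y0⟩ : Nonempty Y := by
    by_contra hY
    rw [not_nonempty_iff] at hY
    have := (Q star).2.2
    simp at this
  -- Used for only finitely many `n`; `A = 2` keeps the time horizon nonempty even for `n = 0`.
  have dflt : ∀ n, AsyncCode X Y n := fun n =>
    AsyncCode.ofStopRule (M := 2) (A := 2) le_rfl (by norm_num) (by omega) (fun _ _ => star) y0
      (fun _ _ => True) (fun _ => 0)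
  let P : ℕ → ℕ → Prop := fun n k =>
    ∃ c : AsyncCode X Y n, c.Meets Q star R α (1 / ((k : ℝ) + 1))
  -- The `n`-th code meets the best tolerance `1 / (k + 1)` with `k ≤ n` available at length `n`.
  let g : ℕ → ℕ := fun n => Nat.findGreatest (P n) n
  refine ⟨fun n => if hn : P n (g n) then hn.choose else dflt n, fun ε hε => ?_⟩
  obtain ⟨k, hk⟩ := exists_nat_one_div_lt hε
  filter_upwards [h' k, eventually_ge_atTop k] with n hn hkn
  have h1 : P n (g n) := Nat.findGreatest_spec hkn hn
  have h2 : k ≤ g n := Nat.le_findGreatest hkn hn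
  rw [dif_pos h1]
  refine h1.choose_spec.mono (le_trans ?_ hk.le)
  have : (k : ℝ) ≤ g n := by exact_mod_cast h2
  exact one_div_le_one_div_of_le (by positivity) (by linarith)

lemma tendsto_pow_mul_exp_neg {c : ℝ} (hc : 0 < c) (d : ℕ) :
    Tendsto (fun n : ℕ => ((n : ℝ) + 1) ^ d * Real.exp (-(c * n))) atTop (𝓝 0) := by
  have h1 : Tendsto (fun n : ℕ => c * ((n : ℝ) + 1)) atTop atTop :=
    (tendsto_natCast_atTop_atTop.atTop_add tendsto_const_nhds).const_mul_atTop hc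
  have h2 := ((Real.tendsto_pow_mul_exp_neg_atTop_nhds_zero d).comp h1).const_mul
    (Real.exp c / c ^ d)
  rw [mul_zero] at h2
  refine h2.congr fun n => ?_
  simp only [Function.comp]
  rw [mul_pow, show -(c * ((n : ℝ) + 1)) = -(c * n) + -c by ring, Real.exp_add, Real.exp_neg c]
  have := Real.exp_pos c
  field_simp

/-- The supremum over the finite alphabet is attained, and an infinite divergence means that
absolute continuity fails. -/
lemma exists_missProb_lt_one (Q : Channel X Y) (star : X) (hQ : syncThreshold Q star = ⊤) :
    ∃ x, missProb Q star x < 1 := by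
  have h1 : ∃ x, kl (Q x) (Q star) = ⊤ := by
    by_contra hc
    push Not at hc
    have : Nonempty X := ⟨star⟩
    obtain ⟨x, hx⟩ := exists_eq_ciSup_of_finite (f := fun x => kl (Q x) (Q star))
    exact hc x (hx.trans hQ)
  obtain ⟨x, hx⟩ := h1
  have h2 : ¬ ∀ y, (Q star).1 y = 0 → (Q x).1 y = 0 := by
    intro hac
    rw [kl_of_ac hac] at hx
    exact ENNReal.ofReal_ne_top hx
  push Not at h2
  obtain ⟨y, hy, hxy⟩ := h2
  refine ⟨x, ?_⟩
  rw [← (Q x).2.2]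
  refine Finset.sum_lt_sum (fun b _ => mul_le_of_le_one_right ((Q x).2.1 b) (ind_le_one _))
    ⟨y, Finset.mem_univ y, ?_⟩
  have hs : ind (¬ Surprising Q star y) = 0 := ind_neg (not_not.2 hy)
  rw [hs, mul_zero]
  exact lt_of_le_of_ne ((Q x).2.1 y) (Ne.symm hxy)

lemma exists_not_surprising (Q : Channel X Y) (star : X) : ∃ y, ¬ Surprising Q star y := by
  by_contra hc
  push Not at hc
  have h := (Q star).2.2
  rw [Finset.sum_eq_zero fun y _ => hc y] at h
  exact zero_ne_one h

lemma exists_ratio_bound (Q : Channel X Y) (star x : X) :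
    ∃ K : ℝ, 1 ≤ K ∧ ∀ y, ¬ Surprising Q star y → (Q x).1 y ≤ K * (Q star).1 y := by
  refine ⟨1 + ∑ y, (Q x).1 y / (Q star).1 y, ?_, fun y hy => ?_⟩
  · have : 0 ≤ ∑ y, (Q x).1 y / (Q star).1 y :=
      Finset.sum_nonneg fun y _ => div_nonneg ((Q x).2.1 y) ((Q star).2.1 y)
    linarith
  · have hpos : 0 < (Q star).1 y := lt_of_le_of_ne ((Q star).2.1 y) (Ne.symm hy)
    rw [← div_le_iff₀ hpos]
    have := Finset.single_le_sum (f := fun y => (Q x).1 y / (Q star).1 y)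
      (fun y _ => div_nonneg ((Q x).2.1 y) ((Q star).2.1 y)) (Finset.mem_univ y)
    linarith

/-- Rounding down a number that is at least one loses at most a factor two, which `exp (ε n)`
absorbs. -/
lemma floor_exp_bounds {α ε : ℝ} (hα : 0 ≤ α) {n : ℕ} (hn : Real.log 2 ≤ ε * n) :
    1 ≤ ⌊Real.exp (α * n)⌋₊ ∧ Real.exp ((α - ε) * n) ≤ ⌊Real.exp (α * n)⌋₊ ∧
      (⌊Real.exp (α * n)⌋₊ : ℝ) ≤ Real.exp (α * n) := by
  have h1 : 1 ≤ Real.exp (α * n) := Real.one_le_exp (by positivity)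
  have h2 : 1 ≤ ⌊Real.exp (α * n)⌋₊ := Nat.le_floor (by simpa using h1)
  refine ⟨h2, ?_, Nat.floor_le (by positivity)⟩
  have h3 := Nat.lt_floor_add_one (Real.exp (α * n))
  have h4 : (1 : ℝ) ≤ ⌊Real.exp (α * n)⌋₊ := by exact_mod_cast h2
  have h5 : Real.exp ((α - ε) * n) * 2 ≤ Real.exp (α * n) := by
    calc Real.exp ((α - ε) * n) * 2 = Real.exp ((α - ε) * n + Real.log 2) := by
          rw [Real.exp_add, Real.exp_log (by norm_num)]
      _ ≤ _ := Real.exp_le_exp.2 (by linarith)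
  linarith

lemma eventually_linear_le {c d : ℝ} (hc : 0 < c) : ∀ᶠ n : ℕ in atTop, d ≤ c * n :=
  (tendsto_natCast_atTop_atTop.const_mul_atTop hc).eventually_ge_atTop d

/-- Here `ν` is the length `n`. The overheads `2 a + 1` and `2 ν r` are paid by the slack `ε / 2 *
kk`, which is about `ε γ ν / 2`. -/
lemma rate_arithmetic {R ε γ r ν a kk : ℝ} (hε : 0 ≤ ε) (hγ : 0 ≤ γ) (hr : 0 ≤ r)
    (hν : 0 ≤ ν) (ha : 0 ≤ a) (h1 : r * (32 * R) ≤ ε * γ) (h2 : γ * ν ≤ kk + 1)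
    (h3 : R * (2 * a + 1) + ε / 2 ≤ ε * γ / 4 * ν) :
    (R - ε) * (2 * a + kk + 2 * ν * r + 1) ≤ (R - ε / 2) * kk := by
  have h4 : (R - ε) * (2 * a + 2 * ν * r + 1) ≤ R * (2 * a + 2 * ν * r + 1) :=
    mul_le_mul_of_nonneg_right (by linarith) (by positivity)
  have h5 : r * (32 * R) * ν ≤ ε * γ * ν := mul_le_mul_of_nonneg_right h1 hν
  have h6 : ε / 2 * (γ * ν) ≤ ε / 2 * (kk + 1) := mul_le_mul_of_nonneg_left h2 (by positivity)
  have h7 : 0 ≤ ε * γ * ν := by positivity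
  linarith

theorem eventually_exists_meets (Q : Channel X Y) (star : X) (hQ : syncThreshold Q star = ⊤)
    {R α : ℝ≥0} (hR : (R : ℝ≥0∞) ≤ syncCapacity Q) (hα : (α : ℝ≥0∞) < alphaBar Q star)
    {ε : ℝ} (hε : 0 < ε) (hεR : ε < R) :
    ∀ᶠ n : ℕ in atTop, ∃ c : AsyncCode X Y n, c.Meets Q star R α ε := by
  have hRpos : (0 : ℝ) < R := hε.trans hεR
  -- block codes of rate close to `R`
  obtain ⟨R', hR', hRR'⟩ : ∃ R' : ℝ≥0, SyncAchievable Q R' ∧ (R : ℝ) - ε / 4 < R' := by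
    have h1 : ((R - (ε / 4).toNNReal : ℝ≥0) : ℝ≥0∞) < syncCapacity Q := by
      refine lt_of_lt_of_le ?_ hR
      rw [ENNReal.coe_lt_coe]
      refine tsub_lt_self (by exact_mod_cast hRpos) (by simpa using hε)
    obtain ⟨-, ⟨R', hR', rfl⟩, h2⟩ := lt_sSup_iff.1 h1
    refine ⟨R', hR', ?_⟩
    have h3 : R - (ε / 4).toNNReal < R' := ENNReal.coe_lt_coe.1 h2
    have h4 : ((R - (ε / 4).toNNReal : ℝ≥0) : ℝ) < R' := by exact_mod_cast h3
    have h5 : (R : ℝ) - ((ε / 4).toNNReal : ℝ≥0) ≤ ((R - (ε / 4).toNNReal : ℝ≥0) : ℝ) := by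
      rw [NNReal.coe_sub_def]
      exact le_max_left _ _
    rw [Real.coe_toNNReal _ (by positivity)] at h5
    linarith
  obtain ⟨blk, hblk⟩ := hR'
  have hblk4 := hblk (ε / 4) (by positivity)
  -- a tail type that beats the exponent `α`
  obtain ⟨P, hP⟩ := lt_iSup_iff.1 hα
  obtain ⟨b, hb0, hαb, hb⟩ := ENNReal.lt_iff_exists_real_btwn.1 hP
  have hαb' : (α : ℝ) < b := by
    rw [← ENNReal.ofReal_coe_nnreal] at hαb
    exact (ENNReal.ofReal_lt_ofReal_iff_of_nonneg α.2).1 hαb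
  have hbpos : 0 < b := lt_of_le_of_lt α.2 hαb'
  obtain ⟨B0, hB0⟩ := exists_word_maxDiv_ge Q star P hb0 hb
  -- Preamble and block take at most `2 γ n` letters, so the exponent of the tail is at least `(1 -
  -- 2 γ) b = (α + b) / 2 > α`.
  set γ : ℝ := (b - α) / (4 * b) with hγ
  have hγpos : 0 < γ := div_pos (by linarith) (by linarith)
  have hγ4 : γ ≤ 1 / 4 := by
    rw [hγ, div_le_iff₀ (by linarith)]
    have : (0 : ℝ) ≤ α := α.2
    linarith
  have hγb : (1 - 2 * γ) * b = (α + b) / 2 := by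
    rw [hγ]
    field_simp
    ring
  -- the preamble
  obtain ⟨x, hx⟩ := exists_missProb_lt_one Q star hQ
  obtain ⟨y0, hy0⟩ := exists_not_surprising Q star
  obtain ⟨K, hK, hKx⟩ := exists_ratio_bound Q star x
  -- `J` does not depend on `n`, so `a` and `K ^ a` stay constant. The second bound makes the delay
  -- `2 n r` caused by a failed preamble negligible against `γ n`.
  obtain ⟨J, hJ⟩ := exists_pow_lt_of_lt_one
    (lt_min (by positivity : 0 < ε / 8) (by positivity : 0 < ε * γ / (32 * R))) hx
  have hJ1 := hJ.trans_le (min_le_left _ _)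
  have hJ2 := hJ.trans_le (min_le_right _ _)
  rw [lt_div_iff₀ (by positivity)] at hJ2
  set r := missProb Q star x ^ J with hr
  have hr0 : 0 ≤ r := pow_nonneg (missProb_nonneg Q star x) J
  obtain ⟨a, ha⟩ : ∃ a, a = 2 ^ (2 * J) := ⟨_, rfl⟩
  set d := Fintype.card X * Fintype.card Y with hd
  -- asymptotics
  have hkk : Tendsto (fun n : ℕ => ⌊γ * n⌋₊) atTop atTop :=
    tendsto_nat_floor_atTop.comp (tendsto_natCast_atTop_atTop.const_mul_atTop hγpos)
  have hzero : Tendsto (fun n : ℕ => K ^ a *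
      (((n : ℝ) + 1) ^ (d + 1) * Real.exp (-((b - α) / 2 * n)))) atTop (𝓝 0) := by
    have := (tendsto_pow_mul_exp_neg (c := (b - α) / 2) (by linarith) (d + 1)).const_mul (K ^ a)
    rwa [mul_zero] at this
  have hsmall := hzero.eventually (gt_mem_nhds (lt_min (by positivity : 0 < ε / 4) one_pos))
  filter_upwards [hkk.eventually hblk4, hkk.eventually (eventually_ge_atTop 1), hsmall,
    eventually_linear_le (d := Real.log 2) hε, eventually_linear_le (d := (a : ℝ)) hγpos,
    eventually_linear_le (d := 2 * ((B0 : ℝ) + a + 1)) one_pos,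
    eventually_linear_le (d := R * (2 * a + 1) + ε / 2)
      (by positivity : 0 < ε * γ / 4)] with n hbn hk1 hsm hlog han hBn hlin
  obtain ⟨hrate, herr⟩ := hbn
  set kk := ⌊γ * n⌋₊ with hkkdef
  have hn0 : (0 : ℝ) ≤ n := Nat.cast_nonneg n
  have hkkle : (kk : ℝ) ≤ γ * n := Nat.floor_le (by positivity)
  have hkkgt : γ * n < kk + 1 := Nat.lt_floor_add_one _
  have hγn : γ * n ≤ 1 / 4 * n := mul_le_mul_of_nonneg_right hγ4 hn0
  have hsum : a + kk ≤ n := by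
    have : (a : ℝ) + kk ≤ n := by linarith
    exact_mod_cast this
  obtain ⟨B, hB⟩ : ∃ B, n = a + kk + B := ⟨n - (a + kk), by omega⟩
  have hBr : (n : ℝ) = a + kk + B := by exact_mod_cast hB
  have hBB0 : B0 ≤ B := by
    have : (B0 : ℝ) ≤ B := by linarith
    exact_mod_cast this
  have haB : a < B := by
    have : (a : ℝ) < B := by linarith
    exact_mod_cast this
  have hBlow : (1 - 2 * γ) * n ≤ B := by linarith
  obtain ⟨w, hw⟩ := hB0 B hBB0
  have htest : testError Q star w ≤ ((n : ℝ) + 1) ^ d * Real.exp (-((α + b) / 2 * n)) := by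
    refine (sum_min_memoryless_le Q (fun _ => Q star) w hw).trans ?_
    refine mul_le_mul ?_ (Real.exp_le_exp.2 ?_) (Real.exp_pos _).le (by positivity)
    · exact pow_le_pow_left₀ (by positivity) (by linarith [(Nat.cast_nonneg kk : (0 : ℝ) ≤ kk),
        (Nat.cast_nonneg a : (0 : ℝ) ≤ a)]) d
    · have h1 := mul_le_mul_of_nonneg_right hBlow hbpos.le
      have h2 : (1 - 2 * γ) * n * b = (α + b) / 2 * n := by rw [← hγb]; ring
      linarith
  obtain ⟨hA1, hAlow, hAup⟩ := floor_exp_bounds (α := α) (ε := ε) α.2 hlog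
  obtain ⟨A, hA⟩ : ∃ A, A = ⌊Real.exp ((α : ℝ) * n)⌋₊ := ⟨_, rfl⟩
  rw [← hA] at hA1 hAlow hAup
  have hlogM : ((R : ℝ) - ε / 2) * kk ≤ Real.log (blk kk).M := by
    refine le_trans (mul_le_mul_of_nonneg_right ?_ (Nat.cast_nonneg kk)) hrate
    linarith
  have hk1' : (1 : ℝ) ≤ kk := by exact_mod_cast hk1
  have hM : 2 ≤ (blk kk).M := by
    by_contra hc
    have h1 : (blk kk).M = 1 := by have := (blk kk).one_le_M; omega
    rw [h1, Nat.cast_one, Real.log_one] at hlogM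
    have h2 : 0 < ((R : ℝ) - ε / 2) * kk := mul_pos (by linarith) (by linarith)
    linarith
  have hAn : ((A + n : ℕ) : ℝ) ≤ ((n : ℝ) + 1) * Real.exp ((α : ℝ) * n) := by
    have : 1 ≤ Real.exp ((α : ℝ) * n) := Real.one_le_exp (mul_nonneg α.2 hn0)
    have h2 := mul_le_mul_of_nonneg_left this hn0
    push_cast
    linarith
  have hprod : ((A + n : ℕ) : ℝ) * (K ^ a * testError Q star w) ≤ min (ε / 4) 1 := by
    refine le_trans ?_ hsm.le
    have hKa : 0 ≤ K ^ a := pow_nonneg (by linarith) a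
    calc ((A + n : ℕ) : ℝ) * (K ^ a * testError Q star w)
        ≤ (((n : ℝ) + 1) * Real.exp ((α : ℝ) * n)) *
          (K ^ a * (((n : ℝ) + 1) ^ d * Real.exp (-((α + b) / 2 * n)))) :=
          mul_le_mul hAn (mul_le_mul_of_nonneg_left htest hKa)
            (mul_nonneg hKa (testError_nonneg Q star w)) (by positivity)
      _ = K ^ a * (((n : ℝ) + 1) ^ (d + 1) *
          (Real.exp ((α : ℝ) * n) * Real.exp (-((α + b) / 2 * n)))) := by ring
      _ = _ := by
          rw [← Real.exp_add]
          congr 4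
          ring
  have hprod1 : ((A + n : ℕ) : ℝ) * testError Q star w ≤ 1 := by
    refine le_trans (mul_le_mul_of_nonneg_left ?_ (Nat.cast_nonneg _))
      (hprod.trans (min_le_right _ _))
    exact le_mul_of_one_le_left (testError_nonneg Q star w) (one_le_pow₀ hK)
  have hprod2 := hprod.trans (min_le_left _ _)
  clear hsm hprod htest hsmall hzero hkk hblk4 hblk hw hB0
  -- The length `n` is to be replaced by `a + kk + B`, so `kk` must no longer be defined through
  -- `n`.
  clear_value kk
  subst hB
  refine ⟨syncCode Q star x a (blk kk) hM hA1 haB w y0, ⟨hAlow, hAup⟩, ?_, ?_⟩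
  · refine AsyncCode.le_rate _ Q star (by linarith)
      (AsyncCode.delay_le _ Q star fun m t =>
        syncCode_expectedDelay_le (blk kk) hM hA1 haB w hy0 ha m t) ?_
    refine le_trans ?_ hlogM
    rw [← hr]
    have h1 : (2 * (a : ℝ) + kk) + 2 * ((a + kk + B : ℕ) : ℝ) * r +
        ((A + (a + kk + B) : ℕ) : ℝ) * testError Q star w ≤
        2 * a + kk + 2 * ((a + kk + B : ℕ) : ℝ) * r + 1 := by linarith
    refine (mul_le_mul_of_nonneg_left h1 (by linarith)).trans ?_
    exact rate_arithmetic hε.le hγpos.le hr0 (Nat.cast_nonneg _) (Nat.cast_nonneg a)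
      hJ2.le hkkgt.le hlin
  · refine AsyncCode.maxError_le _ Q star fun m t =>
      (syncCode_errorProb_le (blk kk) hM hA1 haB w hy0 ha hK hKx m t).trans ?_
    rw [← hr]
    linarith

theorem alphaBar_le_asyncCapacity (Q : Channel X Y) (star : X) (hQ : syncThreshold Q star = ⊤)
    {R : ℝ≥0} (hR0 : 0 < R) (hR : (R : ℝ≥0∞) ≤ syncCapacity Q) :
    alphaBar Q star ≤ asyncCapacity Q star R := by
  refine ENNReal.le_of_forall_nnreal_lt fun α hα => ?_
  refine le_sSup ⟨α, ?_, rfl⟩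
  exact achievable_of_forall_eventually Q star R α (by exact_mod_cast hR0) fun ε hε hεR =>
    eventually_exists_meets Q star hQ hR hα hε hεR

end Achievability

/-! ### Second moments and Chebyshev's inequality for independent letters. -/

section SecondMoments

variable {I Y : Type*} [Fintype I] [DecidableEq I] [Fintype Y]

lemma prodE_coord (μ : I → ProbDist Y) (i : I) (f : Y → ℝ) :
    prodE μ (fun y => f (y i)) = ∑ b, (μ i).1 b * f b := by
  rw [prodE_comp μ (e := fun _ : Fin 1 => i) (fun _ _ _ => Subsingleton.elim _ _)
    (fun z => f (z 0)), prodE]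
  refine Fintype.sum_equiv (Equiv.funUnique (Fin 1) Y) _ _ fun z => ?_
  simp

lemma prodE_mul_coord (μ : I → ProbDist Y) {i k : I} (hik : i ≠ k) (f g : Y → ℝ) :
    prodE μ (fun y => f (y i) * g (y k)) =
      (∑ b, (μ i).1 b * f b) * ∑ b, (μ k).1 b * g b := by
  have h := prodE_mul_of_disjoint μ (e := fun _ : Fin 1 => i) (e' := fun _ : Fin 1 => k)
    (fun _ _ _ => Subsingleton.elim _ _) (fun _ _ _ => Subsingleton.elim _ _) (fun _ _ => hik)
    (fun z => f (z 0)) (fun z => g (z 0))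
  rw [← prodE_coord μ i f, ← prodE_coord μ k g, h]
  congr 1
  · exact (prodE_comp μ (e := fun _ : Fin 1 => i) (fun _ _ _ => Subsingleton.elim _ _)
      (fun z => f (z 0))).symm
  · exact (prodE_comp μ (e := fun _ : Fin 1 => k) (fun _ _ _ => Subsingleton.elim _ _)
      (fun z => g (z 0))).symm

lemma prodE_sq_sum_of_centered (μ : I → ProbDist Y) (g : I → Y → ℝ)
    (h0 : ∀ i, ∑ b, (μ i).1 b * g i b = 0) :
    prodE μ (fun y => (∑ i, g i (y i)) ^ 2) = ∑ i, ∑ b, (μ i).1 b * g i b ^ 2 := by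
  simp only [sq, Finset.sum_mul_sum]
  rw [prodE_finset_sum]
  refine Finset.sum_congr rfl fun i _ => ?_
  rw [prodE_finset_sum, Finset.sum_eq_single i]
  · exact prodE_coord μ i fun b => g i b * g i b
  · intro k _ hk
    rw [prodE_mul_coord μ (Ne.symm hk), h0, zero_mul]
  · simp

/-- Chebyshev's inequality for a sum of independent terms. -/
lemma prodE_sum_gt_le (μ : I → ProbDist Y) (h : I → Y → ℝ) {V δ : ℝ} (hδ : 0 < δ)
    (hV : ∀ i, ∑ b, (μ i).1 b * h i b ^ 2 ≤ V) (hI : 0 < Fintype.card I) :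
    prodE μ (fun y => ind ((∑ i, ∑ b, (μ i).1 b * h i b) + Fintype.card I * δ <
      ∑ i, h i (y i))) ≤ V / (Fintype.card I * δ ^ 2) := by
  set N : ℝ := (Fintype.card I : ℝ) with hN
  have hN0 : 0 < N := Nat.cast_pos.2 hI
  set m : I → ℝ := fun i => ∑ b, (μ i).1 b * h i b with hm
  have hc : ∀ i, ∑ b, (μ i).1 b * (h i b - m i) = 0 := by
    intro i
    simp only [mul_sub, Finset.sum_sub_distrib, ← Finset.sum_mul, (μ i).2.2, one_mul]
    rw [hm, sub_self]
  have hv : ∀ i, ∑ b, (μ i).1 b * (h i b - m i) ^ 2 ≤ V := by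
    intro i
    refine le_trans ?_ (hV i)
    have : ∑ b, (μ i).1 b * (h i b - m i) ^ 2 =
        ∑ b, (μ i).1 b * h i b ^ 2 - m i ^ 2 := by
      have h1 : ∀ b, (μ i).1 b * (h i b - m i) ^ 2 =
          (μ i).1 b * h i b ^ 2 - 2 * m i * ((μ i).1 b * h i b) + m i ^ 2 * (μ i).1 b := by
        intro b
        ring
      simp only [h1, Finset.sum_add_distrib, Finset.sum_sub_distrib, ← Finset.mul_sum, (μ i).2.2]
      rw [hm]
      ring
    rw [this]
    linarith [sq_nonneg (m i)]
  have hle : ∀ y : I → Y, ind ((∑ i, m i) + N * δ < ∑ i, h i (y i)) ≤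
      1 / (N * δ) ^ 2 * (∑ i, (h i (y i) - m i)) ^ 2 := by
    intro y
    by_cases hy : (∑ i, m i) + N * δ < ∑ i, h i (y i)
    · rw [ind_pos hy, one_div, inv_mul_eq_div, one_le_div (by positivity)]
      refine pow_le_pow_left₀ (by positivity) ?_ 2
      rw [Finset.sum_sub_distrib]
      linarith
    · rw [ind_neg hy]
      positivity
  refine (prodE_mono μ hle).trans ?_
  rw [prodE_const_mul, prodE_sq_sum_of_centered μ (fun i b => h i b - m i) hc]
  have h2 : ∑ i, ∑ b, (μ i).1 b * (h i b - m i) ^ 2 ≤ N * V := by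
    refine (Finset.sum_le_sum fun i _ => hv i).trans (le_of_eq ?_)
    rw [Finset.sum_const, Finset.card_univ, nsmul_eq_mul]
  calc 1 / (N * δ) ^ 2 * ∑ i, ∑ b, (μ i).1 b * (h i b - m i) ^ 2
      ≤ 1 / (N * δ) ^ 2 * (N * V) := mul_le_mul_of_nonneg_left h2 (by positivity)
    _ = V / (N * δ ^ 2) := by
        field_simp

/-- Laws that agree on the coordinates on which `f` depends give it the same expectation. -/
lemma prodE_congr_of_dependsOn (μ ν : I → ProbDist Y) (y0 : Y) (p : I → Prop)
    (hμν : ∀ i, p i → μ i = ν i) (f : (I → Y) → ℝ)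
    (hf : ∀ y y', (∀ i, p i → y i = y' i) → f y = f y') : prodE μ f = prodE ν f := by
  classical
  let F : ({i // p i} → Y) → ℝ := fun z => f fun i => if h : p i then z ⟨i, h⟩ else y0
  have hF : f = fun y => F fun i => y i.1 := by
    funext y
    refine hf _ _ fun i hi => ?_
    rw [dif_pos hi]
  rw [hF, prodE_comp μ Subtype.val_injective F, prodE_comp ν Subtype.val_injective F]
  congr 1
  funext i
  exact hμν i i.2

end SecondMoments

/-! ### Concentration of sums over sliding windows of noise. -/

section SlidingWindows

variable {Y : Type*} [Fintype Y] {N n T : ℕ}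

lemma card_close_le (n T : ℕ) (t : Fin T) :
    (Finset.univ.filter fun s : Fin T => s.1 < t.1 + n ∧ t.1 < s.1 + n).card ≤ 2 * n := by
  have h : ∀ s ∈ Finset.univ.filter (fun s : Fin T => s.1 < t.1 + n ∧ t.1 < s.1 + n),
      s.1 ∈ Finset.Ico (t.1 + 1 - n) (t.1 + n) := by
    intro s hs
    have := (Finset.mem_filter.1 hs).2
    rw [Finset.mem_Ico]
    omega
  refine (Finset.card_le_card_of_injOn _ h fun s _ s' _ hss => Fin.ext hss).trans ?_
  rw [Nat.card_Ico]
  omega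

/-- Second moment of the sum over sliding windows of a function of i.i.d. letters. -/
lemma prodE_sq_sum_window_le (q : ProbDist Y) (hT : ∀ t : Fin T, t.1 + n ≤ N)
    (g : (Fin n → Y) → ℝ) {w G : ℝ} (hw : prodE (fun _ => q) g = w)
    (hG : prodE (fun _ => q) (fun z => g z ^ 2) ≤ G) :
    prodE (fun _ : Fin N => q)
      (fun y => (∑ t : Fin T, (g (fun j => y (window t (hT t) j)) - w)) ^ 2) ≤
      T * (2 * n * G) := by
  have hvar : ∀ t : Fin T, prodE (fun _ : Fin N => q)
      (fun y => (g (fun j => y (window t (hT t) j)) - w) ^ 2) ≤ G := by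
    intro t
    rw [prodE_comp _ (window_injective t.1 (hT t)) fun z => (g z - w) ^ 2]
    have : (fun z => (g z - w) ^ 2) = fun z : Fin n → Y => (g z ^ 2 - 2 * w * g z) + w ^ 2 := by
      funext z
      ring
    rw [this, prodE_add, prodE_sub, prodE_const_mul, prodE_const, hw]
    nlinarith [sq_nonneg w]
  have hG0 : 0 ≤ G := (prodE_nonneg _ fun z => sq_nonneg (g z)).trans hG
  -- Disjoint windows are uncorrelated, and a window overlaps at most `2 n` others or itself; for
  -- these the covariance is bounded by the variances.
  have hcov : ∀ t s : Fin T, prodE (fun _ : Fin N => q)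
      (fun y => (g (fun j => y (window t (hT t) j)) - w) *
        (g (fun j => y (window s (hT s) j)) - w)) ≤
      if s.1 < t.1 + n ∧ t.1 < s.1 + n then G else 0 := by
    intro t s
    split_ifs with h
    · refine (prodE_mono _ (g := fun y => 1 / 2 * ((g (fun j => y (window t (hT t) j)) - w) ^ 2 +
        (g (fun j => y (window s (hT s) j)) - w) ^ 2)) fun y => ?_).trans ?_
      · have := two_mul_le_add_sq (g (fun j => y (window t (hT t) j)) - w)
          (g (fun j => y (window s (hT s) j)) - w)
        linarith
      · rw [prodE_const_mul, prodE_add]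
        linarith [hvar t, hvar s]
    · refine le_of_eq ?_
      rw [prodE_mul_of_disjoint _ (window_injective t.1 (hT t)) (window_injective s.1 (hT s)) ?_
        (fun z => g z - w) (fun z => g z - w), prodE_sub, prodE_const, hw, sub_self, zero_mul]
      intro j k hjk
      have : t.1 + j.1 = s.1 + k.1 := congrArg Fin.val hjk
      omega
  simp only [sq, Finset.sum_mul_sum]
  rw [prodE_finset_sum]
  have hrow : ∀ t : Fin T, prodE (fun _ : Fin N => q) (fun y => ∑ s : Fin T,
      (g (fun j => y (window t (hT t) j)) - w) * (g (fun j => y (window s (hT s) j)) - w)) ≤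
      2 * n * G := by
    intro t
    rw [prodE_finset_sum]
    refine (Finset.sum_le_sum fun s _ => hcov t s).trans ?_
    rw [← Finset.sum_filter, Finset.sum_const, nsmul_eq_mul]
    exact mul_le_mul_of_nonneg_right (by exact_mod_cast card_close_le n T t) hG0
  refine (Finset.sum_le_sum fun t _ => hrow t).trans (le_of_eq ?_)
  rw [Finset.sum_const, Finset.card_univ, Fintype.card_fin, nsmul_eq_mul]

/-- Lower bound on the correlation of the number of occurrences with a bounded weight. -/
lemma le_prodE_sum_window_mul (q : ProbDist Y) (hT : ∀ t : Fin T, t.1 + n ≤ N)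
    (g : (Fin n → Y) → ℝ) {w G : ℝ} (hw : prodE (fun _ => q) g = w)
    (hG : prodE (fun _ => q) (fun z => g z ^ 2) ≤ G) (ψ : (Fin N → Y) → ℝ)
    (hψ0 : ∀ y, 0 ≤ ψ y) (hψ1 : ∀ y, ψ y ≤ 1) :
    T * w * prodE (fun _ => q) ψ - Real.sqrt (T * (2 * n * G)) ≤
      prodE (fun _ => q) (fun y => (∑ t : Fin T, g (fun j => y (window t (hT t) j))) * ψ y) := by
  have h1 : ∀ y : Fin N → Y, T * w * ψ y - |∑ t : Fin T, (g (fun j => y (window t (hT t) j)) - w)| ≤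
      (∑ t : Fin T, g (fun j => y (window t (hT t) j))) * ψ y := by
    intro y
    set D := ∑ t : Fin T, (g (fun j => y (window t (hT t) j)) - w) with hD
    have h2 : ∑ t : Fin T, g (fun j => y (window t (hT t) j)) = D + T * w := by
      rw [hD, Finset.sum_sub_distrib, Finset.sum_const, Finset.card_univ, Fintype.card_fin,
        nsmul_eq_mul]
      ring
    rw [h2]
    have h3 : -|D| ≤ D * ψ y := by
      have h4 : |D * ψ y| ≤ |D| := by
        rw [abs_mul, abs_of_nonneg (hψ0 y)]
        exact mul_le_of_le_one_right (abs_nonneg D) (hψ1 y)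
      linarith [neg_abs_le (D * ψ y)]
    linarith
  refine le_trans ?_ (prodE_mono _ h1)
  rw [prodE_sub, prodE_const_mul]
  refine sub_le_sub_left ?_ _
  exact (prodE_abs_le_sqrt _ _).trans
    (Real.sqrt_le_sqrt (prodE_sq_sum_window_le q hT g hw hG))

end SlidingWindows

/-! ### Concentration of log-likelihood ratios and the confusing density. -/

section Typicality

variable {X Y : Type*} [Fintype X] [Fintype Y]

/-- With `p = s ^ 2` this follows from `|s log s| ≤ 1`. It makes Chebyshev's bound uniform over the
auxiliary channel `W`, which changes with `n`. -/
lemma mul_log_sq_le {p : ℝ} (h0 : 0 ≤ p) (h1 : p ≤ 1) : p * Real.log p ^ 2 ≤ 4 := by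
  rcases h0.eq_or_lt with h | h
  · rw [← h]
    norm_num
  · set s := Real.sqrt p with hs
    have hs0 : 0 < s := Real.sqrt_pos.2 h
    have hs1 : s ≤ 1 := Real.sqrt_le_one.2 h1
    have hp : p = s ^ 2 := (Real.sq_sqrt h0).symm
    have h2 := Real.abs_log_mul_self_lt s hs0 hs1
    have h3 : (Real.log s * s) ^ 2 ≤ 1 := by
      rw [← sq_abs]
      exact pow_le_one₀ (abs_nonneg _) h2.le
    have h4 : Real.log p = 2 * Real.log s := by
      rw [hp, Real.log_pow]
      norm_num
    rw [h4, hp]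
    nlinarith

lemma coord_le_one (p : ProbDist Y) (y : Y) : p.1 y ≤ 1 := by
  rw [← p.2.2]
  exact Finset.single_le_sum (f := p.1) (fun b _ => p.2.1 b) (Finset.mem_univ y)

/-- A bound on the second moment of the log-likelihood ratio, uniform in the first argument. -/
def llrBound (q : ProbDist Y) : ℝ := ∑ y, (8 + 2 * Real.log (q.1 y) ^ 2)

lemma llrBound_nonneg (q : ProbDist Y) : 0 ≤ llrBound q :=
  Finset.sum_nonneg fun y _ => by positivity

lemma sum_mul_llr_sq_le {p q : ProbDist Y} (h : ∀ y, q.1 y = 0 → p.1 y = 0) :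
    ∑ y, p.1 y * Real.log (p.1 y / q.1 y) ^ 2 ≤ llrBound q := by
  refine Finset.sum_le_sum fun y _ => ?_
  have hp0 := p.2.1 y
  have hp1 := coord_le_one p y
  by_cases hp : p.1 y = 0
  · rw [hp, zero_mul]
    positivity
  · have hq : q.1 y ≠ 0 := fun h0 => hp (h y h0)
    rw [Real.log_div hp hq]
    have h1 := mul_log_sq_le hp0 hp1
    have h2 : p.1 y * Real.log (q.1 y) ^ 2 ≤ Real.log (q.1 y) ^ 2 :=
      mul_le_of_le_one_left (sq_nonneg _) hp1
    have h3 : (Real.log (p.1 y) - Real.log (q.1 y)) ^ 2 ≤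
        2 * Real.log (p.1 y) ^ 2 + 2 * Real.log (q.1 y) ^ 2 := by
      linarith [sq_nonneg (Real.log (p.1 y) + Real.log (q.1 y))]
    have h4 := mul_le_mul_of_nonneg_left h3 hp0
    linarith

variable {n : ℕ}

lemma memoryless_eq_exp_mul {W V : Channel X Y} {cw : Fin n → X} {z : Fin n → Y}
    (hac : ∀ j y, (V (cw j)).1 y = 0 → (W (cw j)).1 y = 0) (hz : memoryless W cw z ≠ 0) :
    memoryless W cw z = Real.exp (∑ j, Real.log ((W (cw j)).1 (z j) / (V (cw j)).1 (z j))) *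
      memoryless V cw z := by
  have hW : ∀ j, 0 < (W (cw j)).1 (z j) := fun j =>
    lt_of_le_of_ne ((W (cw j)).2.1 _) fun h0 =>
      hz (Finset.prod_eq_zero (Finset.mem_univ j) h0.symm)
  have hV : ∀ j, 0 < (V (cw j)).1 (z j) := fun j =>
    lt_of_le_of_ne ((V (cw j)).2.1 _) fun h0 => (hW j).ne' (hac j _ h0.symm)
  rw [Real.exp_sum, memoryless, memoryless, ← Finset.prod_mul_distrib]
  refine Finset.prod_congr rfl fun j _ => ?_
  rw [Real.exp_log (div_pos (hW j) (hV j)), div_mul_cancel₀ _ (hV j).ne']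

/-- Under `W`, the log-likelihood ratio with respect to `V` concentrates. -/
lemma llr_concentration {W V : Channel X Y} {cw : Fin n → X} (hn : 0 < n)
    (hac : ∀ j y, (V (cw j)).1 y = 0 → (W (cw j)).1 y = 0) {β δ K : ℝ} (hδ : 0 < δ)
    (hβ0 : 0 ≤ β)
    (hβ : ∑ j, kl (W (cw j)) (V (cw j)) ≤ ENNReal.ofReal (n * β))
    (hK : ∀ j, llrBound (V (cw j)) ≤ K) :
    prodE (fun j => W (cw j)) (fun z => ind ((n : ℝ) * (β + δ) <
      ∑ j, Real.log ((W (cw j)).1 (z j) / (V (cw j)).1 (z j)))) ≤ K / (n * δ ^ 2) := by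
  have h1 : ∑ j, klReal (W (cw j)) (V (cw j)) ≤ n * β := by
    rw [Finset.sum_congr rfl fun j _ => kl_of_ac (hac j),
      ← ENNReal.ofReal_sum_of_nonneg fun j _ => klReal_nonneg (hac j)] at hβ
    exact (ENNReal.ofReal_le_ofReal_iff (by positivity)).1 hβ
  have h2 := prodE_sum_gt_le (fun j => W (cw j))
    (fun j b => Real.log ((W (cw j)).1 b / (V (cw j)).1 b)) hδ
    (fun j => (sum_mul_llr_sq_le (hac j)).trans (hK j)) (by simpa using hn)
  rw [Fintype.card_fin] at h2
  refine le_trans (prodE_mono _ fun z => ?_) h2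
  by_cases hz : (n : ℝ) * (β + δ) < ∑ j, Real.log ((W (cw j)).1 (z j) / (V (cw j)).1 (z j))
  · rw [ind_pos hz, ind_pos]
    unfold klReal at h1
    linarith
  · rw [ind_neg hz]
    exact ind_nonneg _

/-- Take `g = 1_S W / p`. On `S`, the bound against `p` caps `g`, and the bound against `q` allows
the change of measure from `p` to `q`. -/
lemma exists_truncated_density {Z : Type*} {W p q : Z → ℝ} (hW : ∀ z, 0 ≤ W z)
    (hp : ∀ z, 0 ≤ p z) (hq : ∀ z, 0 ≤ q z) (S : Z → Prop) {G : ℝ} (hG : 0 ≤ G)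
    (hac : ∀ z, p z = 0 → W z = 0) (h1 : ∀ z, S z → W z ≤ G * p z)
    (h2 : ∀ z, S z → W z ≤ G * q z) :
    ∃ g : Z → ℝ, (∀ z, 0 ≤ g z) ∧ (∀ z, g z ≤ G) ∧ (∀ z, g z * p z ≤ G * q z) ∧
      ∀ z, p z * g z = W z * ind (S z) := by
  have hgp : ∀ z, p z * (ind (S z) * W z / p z) = W z * ind (S z) := by
    intro z
    by_cases hpz : p z = 0
    · rw [hpz, hac z hpz, zero_mul, zero_mul]
    · rw [mul_div_cancel₀ _ hpz, mul_comm]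
  refine ⟨fun z => ind (S z) * W z / p z,
    fun z => div_nonneg (mul_nonneg (ind_nonneg _) (hW z)) (hp z), fun z => ?_, fun z => ?_, hgp⟩
  · beta_reduce
    by_cases hSz : S z
    · rw [ind_pos hSz, one_mul]
      exact div_le_of_le_mul₀ (hp z) hG (h1 z hSz)
    · rw [ind_neg hSz, zero_mul, zero_div]
      exact hG
  · rw [mul_comm, hgp z]
    by_cases hSz : S z
    · rw [ind_pos hSz, mul_one]
      exact h2 z hSz
    · rw [ind_neg hSz, mul_zero]
      exact mul_nonneg hG (hq z)

lemma memoryless_le_exp_mul {W V : Channel X Y} {cw : Fin n → X} {z : Fin n → Y} {b : ℝ}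
    (hac : ∀ j y, (V (cw j)).1 y = 0 → (W (cw j)).1 y = 0)
    (hb : ¬ b < ∑ j, Real.log ((W (cw j)).1 (z j) / (V (cw j)).1 (z j))) :
    memoryless W cw z ≤ Real.exp b * memoryless V cw z := by
  by_cases hz : memoryless W cw z = 0
  · rw [hz]
    exact mul_nonneg (Real.exp_pos _).le (memoryless_nonneg _ _ _)
  · rw [memoryless_eq_exp_mul hac hz]
    exact mul_le_mul_of_nonneg_right (Real.exp_le_exp.2 (not_lt.1 hb)) (memoryless_nonneg _ _ _)

lemma prodE_ind_ge (μ : Fin n → ProbDist Y) (S1 S2 : (Fin n → Y) → Prop) :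
    1 - prodE μ (fun z => ind (S1 z)) - prodE μ (fun z => ind (S2 z)) ≤
      prodE μ (fun z => ind (¬ S1 z ∧ ¬ S2 z)) := by
  rw [← prodE_const μ 1, ← prodE_sub, ← prodE_sub]
  refine prodE_mono _ fun z => ?_
  have i1 := ind_nonneg (¬ S1 z ∧ ¬ S2 z)
  have i2 := ind_nonneg (S1 z)
  have i3 := ind_nonneg (S2 z)
  by_cases hz1 : S1 z
  · rw [ind_pos hz1]
    linarith
  · by_cases hz2 : S2 z
    · rw [ind_pos hz2]
      linarith
    · rw [ind_neg hz1, ind_neg hz2, ind_pos ⟨hz1, hz2⟩]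
      norm_num

/-- A bounded density with respect to the noise that the code word can imitate. -/
theorem exists_confusing_density (Q : Channel X Y) (star : X) (cw : Fin n → X) (W : Channel X Y)
    {β δ K : ℝ} (hn : 0 < n) (hδ : 0 < δ) (hβ0 : 0 ≤ β)
    (h1 : ∑ j, kl (W (cw j)) (Q (cw j)) ≤ ENNReal.ofReal (n * β))
    (h2 : ∑ j, kl (W (cw j)) (Q star) ≤ ENNReal.ofReal (n * β))
    (hK : ∀ x, llrBound (Q x) ≤ K) (hnK : 4 * K ≤ n * δ ^ 2) :
    ∃ g : (Fin n → Y) → ℝ, (∀ z, 0 ≤ g z) ∧ (∀ z, g z ≤ Real.exp (n * (β + δ))) ∧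
      (∀ z, g z * memoryless (fun _ => Q star) cw z ≤
        Real.exp (n * (β + δ)) * memoryless Q cw z) ∧
      1 / 2 ≤ prodE (fun _ => Q star) g ∧ prodE (fun _ => Q star) g ≤ 1 := by
  have hac : ∀ V : Channel X Y, ∑ j, kl (W (cw j)) (V (cw j)) ≤ ENNReal.ofReal (n * β) →
      ∀ j y, (V (cw j)).1 y = 0 → (W (cw j)).1 y = 0 := by
    intro V hV j
    refine ac_of_kl_ne_top fun htop => ?_
    have := (ENNReal.sum_lt_top.1 (lt_of_le_of_lt hV ENNReal.ofReal_lt_top)) j (Finset.mem_univ j)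
    exact this.ne htop
  have hac1 := hac Q h1
  have hac2 := hac (fun _ => Q star) h2
  have c1 : prodE (fun j => W (cw j)) (fun z => ind (n * (β + δ) <
      ∑ j, Real.log ((W (cw j)).1 (z j) / (Q (cw j)).1 (z j)))) ≤ K / (n * δ ^ 2) :=
    llr_concentration (V := Q) hn hac1 hδ hβ0 h1 (fun j => hK (cw j))
  have c2 : prodE (fun j => W (cw j)) (fun z => ind (n * (β + δ) <
      ∑ j, Real.log ((W (cw j)).1 (z j) / (Q star).1 (z j)))) ≤ K / (n * δ ^ 2) :=
    llr_concentration (V := fun _ => Q star) hn hac2 hδ hβ0 h2 (fun _ => hK star)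
  have hzero : ∀ z, memoryless (fun _ => Q star) cw z = 0 → memoryless W cw z = 0 := by
    intro z hz
    by_contra hc
    rw [memoryless_eq_exp_mul (V := fun _ => Q star) hac2 hc, hz, mul_zero] at hc
    exact hc rfl
  obtain ⟨g, g0, g1, g2, g3⟩ := exists_truncated_density (W := memoryless W cw)
    (p := memoryless (fun _ => Q star) cw) (q := memoryless Q cw) (memoryless_nonneg W cw)
    (memoryless_nonneg (fun _ => Q star) cw) (memoryless_nonneg Q cw)
    (fun z => ¬ (n * (β + δ) < ∑ j, Real.log ((W (cw j)).1 (z j) / (Q (cw j)).1 (z j))) ∧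
      ¬ (n * (β + δ) < ∑ j, Real.log ((W (cw j)).1 (z j) / (Q star).1 (z j))))
    (Real.exp_pos (n * (β + δ))).le hzero
    (fun z hz => memoryless_le_exp_mul (V := fun _ => Q star) hac2 hz.2)
    (fun z hz => memoryless_le_exp_mul (V := Q) hac1 hz.1)
  have hE : prodE (fun _ => Q star) g = prodE (fun j => W (cw j)) (fun z => ind
      (¬ (n * (β + δ) < ∑ j, Real.log ((W (cw j)).1 (z j) / (Q (cw j)).1 (z j))) ∧
      ¬ (n * (β + δ) < ∑ j, Real.log ((W (cw j)).1 (z j) / (Q star).1 (z j))))) :=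
    Finset.sum_congr rfl fun z _ => g3 z
  refine ⟨g, g0, g1, g2, ?_, ?_⟩
  · rw [hE]
    refine le_trans ?_ (prodE_ind_ge (fun j => W (cw j)) _ _)
    -- Each of the two atypical events loses at most a quarter of the mass.
    have h4 : K / (n * δ ^ 2) ≤ 1 / 4 := by
      have : (0 : ℝ) < n := by exact_mod_cast hn
      rw [div_le_iff₀ (by positivity)]
      linarith
    linarith
  · rw [hE, ← prodE_const (fun j => W (cw j)) 1]
    exact prodE_mono _ fun z => ind_le_one _

end Typicality

/-! ### The converse: reliable decoders above the threshold have exponential delay. -/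

section Converse

open Filter Topology

variable {X Y : Type*} [Fintype X] [Fintype Y] {n : ℕ}

lemma prod_eq_window_mul {N s : ℕ} (h : s + n ≤ N) (f : Fin N → ℝ) :
    ∏ i, f i = (∏ j, f (window s h j)) * ∏ i ∈ (Finset.univ.image (window s h))ᶜ, f i := by
  rw [← Finset.prod_image (f := f) (g := window s h)
    fun j _ j' _ hjj => window_injective s h hjj, Finset.prod_mul_prod_compl]

namespace AsyncCode

variable (c : AsyncCode X Y n) (Q : Channel X Y) (star : X)

lemma start_add_le (t : Fin c.A) : t.1 + n ≤ c.A + n - 1 := by have := t.2; omega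

lemma input_window (m : Fin c.M) (t : Fin c.A) (j : Fin n) :
    c.input star m t (window t.1 (c.start_add_le t) j) = c.codeword m j := by
  unfold input
  have h : t.1 + j.1 - t.1 = j := by omega
  rw [dif_pos (by simp only [window]; omega)]
  simp only [window, h]

lemma input_off_window (m : Fin c.M) (t : Fin c.A) (i : Fin (c.A + n - 1))
    (hi : i ∉ Finset.univ.image (window (B := n) t.1 (c.start_add_le t))) :
    c.input star m t i = star := by
  unfold input
  rw [dif_neg]
  rintro ⟨h1, h2⟩
  refine hi (Finset.mem_image.2 ⟨⟨i.1 - t.1, by omega⟩, Finset.mem_univ _, Fin.ext ?_⟩)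
  simp only [window]
  omega

lemma input_of_lt (m : Fin c.M) (t : Fin c.A) (i : Fin (c.A + n - 1)) (hi : i.1 < t.1) :
    c.input star m t i = star := by
  unfold input
  rw [dif_neg fun h => by omega]

lemma outputProb_nonneg (m : Fin c.M) (t : Fin c.A) (y : Fin (c.A + n - 1) → Y) :
    0 ≤ c.outputProb Q star m t y := memoryless_nonneg _ _ _

/-- Change of measure from the noise to the transmission of a code word. -/
lemma density_mul_noise_le (m : Fin c.M) (t : Fin c.A) {g : (Fin n → Y) → ℝ} {G : ℝ}
    (hg : ∀ z, g z * memoryless (fun _ => Q star) (c.codeword m) z ≤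
      G * memoryless Q (c.codeword m) z) (y : Fin (c.A + n - 1) → Y) :
    g (fun j => y (window t.1 (c.start_add_le t) j)) * ∏ i, (Q star).1 (y i) ≤
      G * c.outputProb Q star m t y := by
  have h1 : c.outputProb Q star m t y =
      memoryless Q (c.codeword m) (fun j => y (window t.1 (c.start_add_le t) j)) *
        ∏ i ∈ (Finset.univ.image (window (B := n) t.1 (c.start_add_le t)))ᶜ,
          (Q star).1 (y i) := by
    unfold outputProb
    rw [memoryless, prod_eq_window_mul (c.start_add_le t)]
    congr 1
    · refine Finset.prod_congr rfl fun j _ => ?_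
      rw [input_window]
    · refine Finset.prod_congr rfl fun i hi => ?_
      rw [input_off_window _ _ _ _ _ (Finset.mem_compl.1 hi)]
  rw [h1, prod_eq_window_mul (c.start_add_le t), ← mul_assoc, ← mul_assoc]
  exact mul_le_mul_of_nonneg_right (hg fun j => y (window t.1 (c.start_add_le t) j))
    (Finset.prod_nonneg fun i _ => (Q star).2.1 _)

/-- The probability, given the outputs, of stopping at an index at least `2 * T`. -/
def lateProb (T : ℕ) (y : Fin (c.A + n - 1) → Y) : ℝ :=
  ∑ k, c.stopProb k y * ind (2 * T ≤ k.1)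

lemma lateProb_nonneg (T : ℕ) (y : Fin (c.A + n - 1) → Y) : 0 ≤ c.lateProb T y :=
  Finset.sum_nonneg fun k _ => mul_nonneg (c.stopProb_nonneg k y) (ind_nonneg _)

lemma lateProb_le_one (T : ℕ) (y : Fin (c.A + n - 1) → Y) : c.lateProb T y ≤ 1 := by
  rw [← c.stopProb_sum y]
  exact Finset.sum_le_sum fun k _ =>
    mul_le_of_le_one_right (c.stopProb_nonneg k y) (ind_le_one _)

lemma expectedDelay_nonneg (m : Fin c.M) (t : Fin c.A) : 0 ≤ c.expectedDelay Q star m t :=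
  Finset.sum_nonneg fun y _ => mul_nonneg (c.outputProb_nonneg Q star m t y)
    (Finset.sum_nonneg fun k _ => mul_nonneg (c.stopProb_nonneg k y) (le_max_left _ _))

lemma errorProb_nonneg (m : Fin c.M) (t : Fin c.A) : 0 ≤ c.errorProb Q star m t :=
  Finset.sum_nonneg fun y _ => mul_nonneg (c.outputProb_nonneg Q star m t y)
    (Finset.sum_nonneg fun k _ => by
      split_ifs
      · exact c.stopProb_nonneg k y
      · exact le_rfl)

lemma sum_expectedDelay_le (m : Fin c.M) :
    ∑ t, c.expectedDelay Q star m t ≤ c.A * c.delay Q star := by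
  have hA : (0 : ℝ) < c.A := by exact_mod_cast c.one_le_A
  rw [← inv_mul_le_iff₀ hA, ← one_div]
  exact le_ciSup (f := fun m : Fin c.M => (1 / (c.A : ℝ)) *
    ∑ t : Fin c.A, c.expectedDelay Q star m t) (Set.finite_range _).bddAbove m

lemma sum_errorProb_le (m : Fin c.M) :
    ∑ t, c.errorProb Q star m t ≤ c.A * c.maxError Q star := by
  have hA : (0 : ℝ) < c.A := by exact_mod_cast c.one_le_A
  rw [← inv_mul_le_iff₀ hA, ← one_div]
  exact le_ciSup (f := fun m : Fin c.M => (1 / (c.A : ℝ)) *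
    ∑ t : Fin c.A, c.errorProb Q star m t) (Set.finite_range _).bddAbove m

/-- Starting before `T` and stopping at `2 * T` or later costs a delay of at least `T`; the change
of measure carries this from weighted noise to the transmission. -/
lemma le_expectedDelay (m : Fin c.M) (t : Fin c.A) {T : ℕ} (ht : t.1 < T)
    {g : (Fin n → Y) → ℝ} {G : ℝ} (hG : 0 ≤ G)
    (hg : ∀ z, g z * memoryless (fun _ => Q star) (c.codeword m) z ≤
      G * memoryless Q (c.codeword m) z) :
    T * prodE (fun _ => Q star) (fun y =>
      g (fun j => y (window t.1 (c.start_add_le t) j)) * c.lateProb T y) ≤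
      G * c.expectedDelay Q star m t := by
  rw [expectedDelay, prodE, Finset.mul_sum, Finset.mul_sum]
  refine Finset.sum_le_sum fun y _ => ?_
  have h1 : T * c.lateProb T y ≤
      ∑ k, c.stopProb k y * max 0 ((k.1 : ℝ) - (t.1 : ℝ)) := by
    rw [lateProb, Finset.mul_sum]
    refine Finset.sum_le_sum fun k _ => ?_
    rw [mul_left_comm]
    refine mul_le_mul_of_nonneg_left ?_ (c.stopProb_nonneg k y)
    by_cases hk : 2 * T ≤ k.1
    · rw [ind_pos hk, mul_one]
      refine le_max_of_le_right ?_
      have h2 : (T : ℝ) + t.1 ≤ k.1 := by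
        have : T + t.1 ≤ k.1 := by omega
        exact_mod_cast this
      linarith
    · rw [ind_neg hk, mul_zero]
      exact le_max_left _ _
  have h2 := c.density_mul_noise_le Q star m t hg y
  have h3 : 0 ≤ T * c.lateProb T y := mul_nonneg (Nat.cast_nonneg _) (c.lateProb_nonneg T y)
  calc _ = (g (fun j => y (window t.1 (c.start_add_le t) j)) * ∏ i, (Q star).1 (y i)) *
        (T * c.lateProb T y) := by ring
    _ ≤ (G * c.outputProb Q star m t y) * (T * c.lateProb T y) :=
        mul_le_mul_of_nonneg_right h2 h3
    _ ≤ (G * c.outputProb Q star m t y) *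
        ∑ k, c.stopProb k y * max 0 ((k.1 : ℝ) - (t.1 : ℝ)) :=
        mul_le_mul_of_nonneg_left h1 (mul_nonneg hG (c.outputProb_nonneg Q star m t y))
    _ = _ := by ring

/-- If the decoder is likely to let noise pass, the delay is large. -/
theorem le_delay (m : Fin c.M) {T : ℕ} (hT : T ≤ c.A) {g : (Fin n → Y) → ℝ} {w G : ℝ}
    (hG : 0 ≤ G)
    (hg : ∀ z, g z * memoryless (fun _ => Q star) (c.codeword m) z ≤
      G * memoryless Q (c.codeword m) z)
    (hw : prodE (fun _ => Q star) g = w)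
    (hg2 : prodE (fun _ => Q star) (fun z => g z ^ 2) ≤ G) :
    T * (T * w * prodE (fun _ => Q star) (c.lateProb T) - Real.sqrt (T * (2 * n * G))) ≤
      c.A * c.delay Q star * G := by
  have h1 := c.sum_expectedDelay_le Q star m
  have h2 : ∑ t : Fin T, c.expectedDelay Q star m (Fin.castLE hT t) ≤
      ∑ t, c.expectedDelay Q star m t := by
    rw [← Finset.sum_image (f := c.expectedDelay Q star m) (g := Fin.castLE hT)
      fun t _ t' _ h => Fin.castLE_injective hT h]
    exact Finset.sum_le_sum_of_subset_of_nonneg (Finset.subset_univ _)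
      fun t _ _ => c.expectedDelay_nonneg Q star m t
  have h3 := le_prodE_sum_window_mul (Q star) (T := T) (N := c.A + n - 1)
    (fun t => c.start_add_le (Fin.castLE hT t)) g hw hg2 (c.lateProb T)
    (c.lateProb_nonneg T) (c.lateProb_le_one T)
  have h4 : T * prodE (fun _ => Q star) (fun y => (∑ t : Fin T, g (fun j =>
      y (window t.1 (c.start_add_le (Fin.castLE hT t)) j))) * c.lateProb T y) ≤
      G * ∑ t : Fin T, c.expectedDelay Q star m (Fin.castLE hT t) := by
    simp only [Finset.sum_mul]
    rw [prodE_finset_sum, Finset.mul_sum, Finset.mul_sum]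
    exact Finset.sum_le_sum fun t _ => c.le_expectedDelay Q star m (Fin.castLE hT t) t.2 hG hg
  have h5 := mul_le_mul_of_nonneg_left h3 (Nat.cast_nonneg T : (0 : ℝ) ≤ T)
  have h6 := mul_le_mul_of_nonneg_left (h2.trans h1) hG
  linarith

/-- What is decided before index `2 * T` depends only on outputs that precede the transmission, and
these are pure noise. -/
lemma early_error_le (m : Fin c.M) (t : Fin c.A) {T : ℕ} (ht : 2 * T ≤ t.1) (y0 : Y) :
    prodE (fun _ => Q star) (fun y => ∑ k, c.stopProb k y * ind (k.1 < 2 * T) *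
      ind (c.decision k y ≠ m)) ≤ c.errorProb Q star m t := by
  have h1 : prodE (fun i => Q (c.input star m t i)) (fun y => ∑ k,
      c.stopProb k y * ind (k.1 < 2 * T) * ind (c.decision k y ≠ m)) ≤
      c.errorProb Q star m t := by
    refine Finset.sum_le_sum fun y _ => ?_
    refine mul_le_mul_of_nonneg_left (Finset.sum_le_sum fun k _ => ?_)
      (c.outputProb_nonneg Q star m t y)
    rw [← mul_ind]
    exact mul_le_mul_of_nonneg_right
      (mul_le_of_le_one_right (c.stopProb_nonneg k y) (ind_le_one _)) (ind_nonneg _)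
  refine le_trans (le_of_eq ?_) h1
  refine prodE_congr_of_dependsOn _ _ y0 (fun i => i.1 < 2 * T) (fun i hi => ?_) _
    fun y y' hyy => ?_
  · rw [input_of_lt _ _ _ _ _ (by omega)]
  · refine Finset.sum_congr rfl fun k _ => ?_
    by_cases hk : k.1 < 2 * T
    · have h2 : ∀ j, j ≤ k → y j = y' j := fun j hj => hyy j (lt_of_le_of_lt hj hk)
      rw [c.stopProb_adapted k y y' h2, c.decision_adapted k y y' h2]
    · rw [ind_neg hk, mul_zero, zero_mul, mul_zero, zero_mul]

/-- The decoder must let noise pass, since otherwise it errs on late messages. -/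
theorem error_ge (T : ℕ) :
    ((c.A : ℝ) - 2 * T) * (1 - prodE (fun _ => Q star) (c.lateProb T)) ≤
      c.A * (2 * c.maxError Q star) := by
  obtain ⟨y0, -⟩ := exists_not_surprising Q star
  have hA : (0 : ℝ) < c.A := by exact_mod_cast c.one_le_A
  have h2M := c.two_le_M
  set e : Fin c.M → ℝ := fun m => prodE (fun _ => Q star) (fun y : Fin (c.A + n - 1) → Y =>
    ∑ k, c.stopProb k y * ind (k.1 < 2 * T) * ind (c.decision k y ≠ m)) with he
  have he0 : ∀ m, 0 ≤ e m := fun m => prodE_nonneg _ fun y => Finset.sum_nonneg fun k _ =>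
    mul_nonneg (mul_nonneg (c.stopProb_nonneg k y) (ind_nonneg _)) (ind_nonneg _)
  have h1 : ∀ m, ((c.A : ℝ) - 2 * T) * e m ≤ c.A * c.maxError Q star := by
    intro m
    have h2 := c.sum_errorProb_le Q star m
    have h3 : ∑ t : Fin c.A, (e m * (1 - ind (t.1 < 2 * T))) ≤ ∑ t, c.errorProb Q star m t := by
      refine Finset.sum_le_sum fun t _ => ?_
      by_cases ht : t.1 < 2 * T
      · rw [ind_pos ht, sub_self, mul_zero]
        exact c.errorProb_nonneg Q star m t
      · rw [ind_neg ht, sub_zero, mul_one]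
        exact c.early_error_le Q star m t (not_lt.1 ht) y0
    have h4 : ∑ t : Fin c.A, ind (t.1 < 2 * T) ≤ 2 * T := by
      classical
      have h5 : ∀ t : Fin c.A, ind (t.1 < 2 * T) = if t.1 < 2 * T then 1 else 0 := fun t => by
        rw [← mul_ind, one_mul]
      simp only [h5]
      rw [Finset.sum_boole]
      have h6 : (Finset.univ.filter fun t : Fin c.A => t.1 < 2 * T).card ≤
          (Finset.range (2 * T)).card :=
        Finset.card_le_card_of_injOn (fun t => t.1)
          (fun t ht => Finset.mem_coe.2 (Finset.mem_range.2 (Finset.mem_filter.1 ht).2))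
          (fun t _ t' _ h => Fin.ext h)
      rw [Finset.card_range] at h6
      exact_mod_cast h6
    rw [← Finset.mul_sum, Finset.sum_sub_distrib, Finset.sum_const, Finset.card_univ,
      Fintype.card_fin, nsmul_eq_mul, mul_one] at h3
    have h7 := mul_le_mul_of_nonneg_left h4 (he0 m)
    linarith
  -- An early decision is wrong for at least one of two messages.
  have h2 : 1 - prodE (fun _ => Q star) (c.lateProb T) ≤
      e ⟨0, by omega⟩ + e ⟨1, by omega⟩ := by
    rw [← prodE_const (fun _ : Fin (c.A + n - 1) => Q star) 1, ← prodE_sub, he]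
    simp only
    rw [← prodE_add]
    refine prodE_mono _ fun y => ?_
    rw [← c.stopProb_sum y, lateProb, ← Finset.sum_sub_distrib, ← Finset.sum_add_distrib]
    refine Finset.sum_le_sum fun k _ => ?_
    have hs := c.stopProb_nonneg k y
    by_cases hk : k.1 < 2 * T
    · rw [ind_neg (not_le.2 hk), ind_pos hk, mul_zero, sub_zero, mul_one, ← mul_add]
      refine le_mul_of_one_le_right hs ?_
      have i0 := ind_nonneg (c.decision k y ≠ ⟨0, by omega⟩)
      have i1 := ind_nonneg (c.decision k y ≠ ⟨1, by omega⟩)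
      by_cases hd : c.decision k y ≠ ⟨0, by omega⟩
      · rw [ind_pos hd]
        linarith
      · have hd1 : c.decision k y ≠ ⟨1, by omega⟩ := by
          rw [not_not.1 hd]
          intro h
          exact absurd (congrArg Fin.val h) (by simp)
        rw [ind_pos hd1]
        linarith
    · rw [ind_pos (not_lt.1 hk), ind_neg hk]
      simp
  by_cases hT : (c.A : ℝ) - 2 * T ≤ 0
  · have h3 : prodE (fun _ => Q star) (c.lateProb T) ≤ 1 := by
      rw [← prodE_const (fun _ : Fin (c.A + n - 1) => Q star) 1]
      exact prodE_mono _ (c.lateProb_le_one T)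
    have h4 : 0 ≤ c.maxError Q star := Real.iSup_nonneg fun m => mul_nonneg (by positivity)
      (Finset.sum_nonneg fun t _ => c.errorProb_nonneg Q star m t)
    have h5 := mul_nonneg (sub_nonneg.2 h3) (neg_nonneg.2 hT)
    have h6 := mul_nonneg hA.le h4
    linarith
  · have h3 := mul_le_mul_of_nonneg_left h2 (not_le.1 hT).le
    have h4 := h1 ⟨0, by omega⟩
    have h5 := h1 ⟨1, by omega⟩
    linarith

/-- Reliable messages have distinct code words. -/
theorem M_le_of_maxError_lt (h : c.maxError Q star < 1 / 2) : c.M ≤ Fintype.card X ^ n := by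
  classical
  have hA : (0 : ℝ) < c.A := by exact_mod_cast c.one_le_A
  have h1 := c.sum_errorProb_le Q star
  have hinj : Function.Injective c.codeword := by
    intro m m' hmm
    by_contra hne
    -- Equal code words induce equal output laws, under which no decision is right for both
    -- messages.
    have h2 : ∀ t, 1 ≤ c.errorProb Q star m t + c.errorProb Q star m' t := by
      intro t
      have h3 : ∀ y, c.outputProb Q star m' t y = c.outputProb Q star m t y := by
        intro y
        have : c.input star m' t = c.input star m t := by
          funext i
          unfold input
          rw [hmm]
        unfold outputProb
        rw [this]
      unfold errorProb
      rw [← Finset.sum_add_distrib]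
      have h4 : ∑ y, c.outputProb Q star m t y = 1 := sum_memoryless Q _
      rw [← h4]
      refine Finset.sum_le_sum fun y _ => ?_
      rw [h3 y, ← mul_add, ← Finset.sum_add_distrib]
      refine le_mul_of_one_le_right (c.outputProb_nonneg Q star m t y) ?_
      rw [← c.stopProb_sum y]
      refine Finset.sum_le_sum fun k _ => ?_
      have hs := c.stopProb_nonneg k y
      by_cases hd : c.decision k y ≠ m
      · rw [if_pos hd]
        split_ifs <;> linarith
      · rw [if_neg hd, if_pos, zero_add]
        rw [not_not.1 hd]
        exact hne
    have h5 := Finset.sum_le_sum fun t (_ : t ∈ Finset.univ) => h2 t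
    rw [Finset.sum_add_distrib, Finset.sum_const, Finset.card_univ, Fintype.card_fin,
      nsmul_eq_mul, mul_one] at h5
    have h6 := h1 m
    have h7 := h1 m'
    have h8 := mul_lt_mul_of_pos_left h hA
    linarith
  have := Fintype.card_le_of_injective _ hinj
  simpa using this

end AsyncCode

/-- Every code word has a channel that makes it look like noise at a cost of at most `β`. -/
lemma exists_confusing_channel (Q : Channel X Y) (star : X) {β : ℝ}
    (hβ : alphaBar Q star < ENNReal.ofReal β) (hn : 0 < n) (cw : Fin n → X) :
    ∃ W : Channel X Y, ∑ j, kl (W (cw j)) (Q (cw j)) ≤ ENNReal.ofReal (n * β) ∧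
      ∑ j, kl (W (cw j)) (Q star) ≤ ENNReal.ofReal (n * β) := by
  classical
  have hn' : (0 : ℝ) < n := by exact_mod_cast hn
  have hcount : ∑ x, ((Finset.univ.filter fun j => cw j = x).card : ℝ) = n := by
    have := Finset.card_eq_sum_card_fiberwise (s := (Finset.univ : Finset (Fin n)))
      (t := Finset.univ) (f := cw) (fun _ _ => Finset.mem_coe.2 (Finset.mem_univ _))
    rw [Finset.card_univ, Fintype.card_fin] at this
    exact_mod_cast this.symm
  -- The type of the code word: divergences along the word are then `n` times conditional
  -- divergences given `P`.
  let P : ProbDist X := ⟨fun x => (Finset.univ.filter fun j => cw j = x).card / n,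
    fun x => by positivity, by rw [← Finset.sum_div, hcount, div_self hn'.ne']⟩
  obtain ⟨W, hW⟩ := iInf_lt_iff.1 ((le_iSup
    (fun P : ProbDist X => ⨅ W : Channel X Y, maxDiv Q star P W) P).trans_lt hβ)
  have hsum : ∀ V : Channel X Y, ∑ j, kl (W (cw j)) (V (cw j)) = n * condKL W V P := by
    intro V
    rw [← Finset.sum_fiberwise Finset.univ cw, condKL, Finset.mul_sum]
    refine Finset.sum_congr rfl fun x _ => ?_
    have h1 : ∀ j ∈ Finset.univ.filter (fun j => cw j = x),
        kl (W (cw j)) (V (cw j)) = kl (W x) (V x) := by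
      intro j hj
      rw [(Finset.mem_filter.1 hj).2]
    rw [Finset.sum_congr rfl h1, Finset.sum_const, nsmul_eq_mul, ← mul_assoc,
      ← ENNReal.ofReal_natCast n, ← ENNReal.ofReal_mul hn'.le]
    congr 1
    simp only [P]
    rw [mul_div_cancel₀ _ hn'.ne', ENNReal.ofReal_natCast]
  have hle : ∀ V : Channel X Y, condKL W V P ≤ ENNReal.ofReal β →
      ∑ j, kl (W (cw j)) (V (cw j)) ≤ ENNReal.ofReal (n * β) := by
    intro V hV
    rw [hsum, ENNReal.ofReal_mul hn'.le, ENNReal.ofReal_natCast]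
    exact mul_le_mul_right hV _
  exact ⟨W, hle Q ((le_max_left _ _).trans hW.le),
    hle (fun _ => Q star) ((le_max_right _ _).trans hW.le)⟩

/-- Since `T ≥ A / 4 ≥ G E / 4 ≥ 128 n G`, the fluctuation is at most `T / 8`, while the main term
`T w ψ` is at least `T / 4`. Hence `A D G ≥ T ^ 2 / 8 ≥ A ^ 2 / 128`. -/
lemma delay_arithmetic {A T G D E n w ψ : ℝ} (hG : 0 < G) (hT : 0 ≤ T)
    (hAT : A ≤ 4 * T) (hA : 0 < A) (hw : 1 / 2 ≤ w) (hψ : 1 / 2 ≤ ψ) (hE : G * E ≤ A)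
    (hEn : 512 * n ≤ E)
    (h : T * (T * w * ψ - Real.sqrt (T * (2 * n * G))) ≤ A * D * G) : E ≤ 128 * D := by
  have h1 : 128 * n * G ≤ T := by
    have := mul_le_mul_of_nonneg_left hEn hG.le
    linarith
  have h2 : Real.sqrt (T * (2 * n * G)) ≤ T / 8 := by
    rw [Real.sqrt_le_left (by positivity)]
    have := mul_le_mul_of_nonneg_left h1 hT
    linarith
  have h3 : 1 / 4 ≤ w * ψ := by nlinarith
  have h4 : T * (T / 8) ≤ T * (T * w * ψ - Real.sqrt (T * (2 * n * G))) := by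
    refine mul_le_mul_of_nonneg_left ?_ hT
    have := mul_le_mul_of_nonneg_left h3 hT
    linarith
  have h5 : A * A ≤ 4 * T * (4 * T) := mul_le_mul hAT hAT hA.le (by positivity)
  have h6 : A * (G * E) ≤ A * (128 * D * G) := by
    have := mul_le_mul_of_nonneg_left hE hA.le
    linarith
  have h7 := le_of_mul_le_mul_left h6 hA
  exact le_of_mul_le_mul_left (by linarith) hG

theorem not_achievable_of_alphaBar_lt (Q : Channel X Y) (star : X) {R α : ℝ≥0} (hR : 0 < R)
    (hα : alphaBar Q star < α) : ¬ Achievable Q star R α := by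
  rintro ⟨c, hc⟩
  have hR' : (0 : ℝ) < R := by exact_mod_cast hR
  obtain ⟨β, hβ0, hβ, hβα⟩ := ENNReal.lt_iff_exists_real_btwn.1 hα
  have hβα' : β < α := by
    rw [← ENNReal.ofReal_coe_nnreal] at hβα
    exact (ENNReal.ofReal_lt_ofReal_iff_of_nonneg hβ0).1 hβα
  -- One `δ` goes to typicality and one to the tolerance on `A`, which leaves `A ≥ G * exp (2 δ n)`.
  set δ : ℝ := (α - β) / 4 with hδ
  have hδ0 : 0 < δ := by
    rw [hδ]
    linarith
  set K : ℝ := ∑ x, llrBound (Q x) with hK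
  have hKx : ∀ x, llrBound (Q x) ≤ K := fun x =>
    Finset.single_le_sum (f := fun x => llrBound (Q x)) (fun x _ => llrBound_nonneg (Q x))
      (Finset.mem_univ x)
  -- `C n` dominates both `512 n`, needed in `delay_arithmetic`, and `128` times the delay, which is
  -- at most `2 n log |X| / R`.
  set C : ℝ := 512 + 512 * Real.log (Fintype.card X) / R with hC
  have hε : 0 < min (min (R / 2 : ℝ) δ) (1 / 12) :=
    lt_min (lt_min (by positivity) hδ0) (by norm_num)
  have hexp : ∀ᶠ n : ℕ in atTop, C * n < Real.exp (2 * δ * n) := by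
    have h1 := tendsto_pow_mul_exp_neg (c := 2 * δ) (by linarith) 1
    have h2 := h1.const_mul C
    rw [mul_zero] at h2
    filter_upwards [h2.eventually (gt_mem_nhds one_pos),
      h1.eventually (gt_mem_nhds one_pos)] with n hn hn'
    rw [pow_one, Real.exp_neg, ← mul_assoc, ← div_eq_mul_inv, div_lt_one (Real.exp_pos _)] at hn
    have hC0 : 0 ≤ C := by
      have : 0 ≤ Real.log (Fintype.card X) := Real.log_natCast_nonneg _
      positivity
    linarith
  obtain ⟨n, hcn, hexpn, hnK, hn0⟩ := ((hc _ hε).and (hexp.and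
    ((eventually_linear_le (d := 4 * K) (by positivity : 0 < δ ^ 2)).and
      (eventually_gt_atTop 0)))).exists
  obtain ⟨⟨hA, -⟩, hrate, herr⟩ := hcn
  have hn0' : (1 : ℝ) ≤ n := by exact_mod_cast hn0
  have herr12 : (c n).maxError Q star ≤ 1 / 12 := herr.trans (min_le_right _ _)
  have hdelay : (R : ℝ) / 2 * (c n).delay Q star ≤ Real.log (c n).M := by
    refine ((c n).le_rate_iff Q star (by positivity)).1
      ((ENNReal.ofReal_le_ofReal ?_).trans hrate)
    have := (min_le_left (min (R / 2 : ℝ) δ) (1 / 12)).trans (min_le_left _ _)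
    linarith
  have hlogM : Real.log (c n).M ≤ n * Real.log (Fintype.card X) := by
    have hM : (0 : ℝ) < (c n).M := by
      have := (c n).two_le_M
      exact_mod_cast (by omega : 0 < (c n).M)
    rw [← Real.log_pow]
    refine Real.log_le_log hM ?_
    exact_mod_cast (c n).M_le_of_maxError_lt Q star (by linarith)
  set G : ℝ := Real.exp (n * (β + δ)) with hG
  have hG0 : 0 < G := Real.exp_pos _
  have hGA : G * Real.exp (2 * δ * n) ≤ (c n).A := by
    refine le_trans ?_ hA
    rw [hG, ← Real.exp_add, Real.exp_le_exp]
    have h1 := (min_le_left (min (R / 2 : ℝ) δ) (1 / 12)).trans (min_le_right _ _)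
    have h2 := mul_le_mul_of_nonneg_right h1 (Nat.cast_nonneg n : (0 : ℝ) ≤ n)
    have h3 : (α : ℝ) = β + 4 * δ := by
      rw [hδ]
      ring
    rw [h3]
    linarith
  have hlogX : 0 ≤ Real.log (Fintype.card X) := Real.log_natCast_nonneg _
  have hC512 : 512 * (n : ℝ) ≤ C * n := by
    refine mul_le_mul_of_nonneg_right ?_ (Nat.cast_nonneg n)
    rw [hC]
    have : 0 ≤ 512 * Real.log (Fintype.card X) / R := by positivity
    linarith
  have hE512 : 512 * (n : ℝ) ≤ Real.exp (2 * δ * n) := hC512.trans hexpn.le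
  have hG1 : 1 ≤ G := Real.one_le_exp (by positivity)
  have hA512 : 512 ≤ (c n).A := by
    have h1 : Real.exp (2 * δ * n) ≤ G * Real.exp (2 * δ * n) :=
      le_mul_of_one_le_left (Real.exp_pos _).le hG1
    have : (512 : ℝ) ≤ (c n).A := by linarith
    exact_mod_cast this
  -- At least a third of the starting times lie beyond `2 T`. With error at most `1 / 12`,
  -- `error_ge` then gives late stopping under noise with probability at least `1 / 2`.
  obtain ⟨T, hT⟩ : ∃ T, T = (c n).A / 3 := ⟨_, rfl⟩
  have hT3 : 3 * (T : ℝ) ≤ (c n).A := by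
    have : 3 * T ≤ (c n).A := by omega
    exact_mod_cast this
  have hT4 : ((c n).A : ℝ) ≤ 4 * T := by
    have : (c n).A ≤ 4 * T := by omega
    exact_mod_cast this
  have hA0 : (0 : ℝ) < (c n).A := by exact_mod_cast (c n).one_le_A
  let m : Fin (c n).M := ⟨0, by have := (c n).two_le_M; omega⟩
  obtain ⟨W, hW1, hW2⟩ := exists_confusing_channel Q star hβ hn0 ((c n).codeword m)
  obtain ⟨g, g0, g1, g2, g3, g4⟩ := exists_confusing_density Q star ((c n).codeword m) W hn0 hδ0
    hβ0 hW1 hW2 hKx (by linarith)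
  have hg2 : prodE (fun _ => Q star) (fun z => g z ^ 2) ≤ G := by
    have h1 : prodE (fun _ => Q star) (fun z => g z ^ 2) ≤
        prodE (fun _ => Q star) (fun z => G * g z) := by
      refine prodE_mono _ fun z => ?_
      rw [sq]
      exact mul_le_mul_of_nonneg_right (g1 z) (g0 z)
    rw [prodE_const_mul] at h1
    have := mul_le_mul_of_nonneg_left g4 hG0.le
    linarith
  have hψ : 1 / 2 ≤ prodE (fun _ => Q star) ((c n).lateProb T) := by
    have h1 := (c n).error_ge Q star T
    have h2 : ((c n).A : ℝ) * (2 * (c n).maxError Q star) ≤ (c n).A * (1 / 6) :=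
      mul_le_mul_of_nonneg_left (by linarith) hA0.le
    by_contra hc'
    push Not at hc'
    have h3 : ((c n).A : ℝ) / 3 * (1 / 2) <
        ((c n).A - 2 * T) * (1 - prodE (fun _ => Q star) ((c n).lateProb T)) :=
      mul_lt_mul' (by linarith) (by linarith) (by norm_num) (by linarith)
    linarith
  have hD := (c n).le_delay Q star m (T := T) (by omega) hG0.le g2 rfl hg2
  have hfin := delay_arithmetic hG0 (Nat.cast_nonneg T) hT4 hA0 g3 hψ hGA
    hE512 hD
  have hlast : 128 * (c n).delay Q star ≤ C * n := by
    have h1 : (c n).delay Q star ≤ 2 / R * (n * Real.log (Fintype.card X)) := by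
      rw [div_mul_eq_mul_div, le_div_iff₀ hR']
      linarith
    have h2 : 128 * (2 / R * (n * Real.log (Fintype.card X))) ≤
        512 * Real.log (Fintype.card X) / R * n := by
      have h3 : 0 ≤ Real.log (Fintype.card X) / R * n := by positivity
      have h4 : 128 * (2 / R * (n * Real.log (Fintype.card X))) =
          256 * (Real.log (Fintype.card X) / R * n) := by ring
      have h5 : 512 * Real.log (Fintype.card X) / R * n =
          512 * (Real.log (Fintype.card X) / R * n) := by ring
      linarith
    rw [hC, add_mul]
    linarith
  linarith

theorem asyncCapacity_le_alphaBar (Q : Channel X Y) (star : X) {R : ℝ≥0} (hR : 0 < R) :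
    asyncCapacity Q star R ≤ alphaBar Q star := by
  refine sSup_le ?_
  rintro - ⟨α, hα, rfl⟩
  exact not_lt.1 fun h => not_achievable_of_alphaBar_lt Q star hR h hα

end Converse

end AsyncComm

end

theorem theorem3 {X Y : Type*} [Fintype X] [Fintype Y] (Q : Channel X Y) (star : X)
    (hQ : syncThreshold Q star = ⊤) :
    (∀ P : ProbDist X, ∃ W : Channel X Y,
      maxDiv Q star P W = ⨅ W' : Channel X Y, maxDiv Q star P W') ∧
    (∃ P : ProbDist X, (⨅ W : Channel X Y, maxDiv Q star P W) = alphaBar Q star) ∧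
    ∀ R : ℝ≥0, 0 < R → (R : ℝ≥0∞) ≤ syncCapacity Q →
      asyncCapacity Q star R = alphaBar Q star :=
  ⟨exists_maxDiv_eq_iInf Q star, exists_iInf_maxDiv_eq_alphaBar Q star, fun _ hR0 hR =>
    le_antisymm (asyncCapacity_le_alphaBar Q star hR0) (alphaBar_le_asyncCapacity Q star hQ hR0 hR)⟩
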